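/- **Theorem.** For a complex Banach space $Y$ and a closed subspace $X\subset Y$ let $\lambda(X,Y)=\inf\{\|P\| : P\in\mathcal L(Y,X),\ P|_X=\mathrm{id}_X\}$ (with $\inf\emptyset=\infty$), and for a complex Banach space $X$ let $\lambda(X)=\sup\lambda(I(X),Y)$, the supremum being taken over all complex Banach spaces $Y$ and all linear isometric embeddings $I\colon X\to Y$ for which $I(X)$ is complemented in $Y$. Let $J\subset\mathbb N=\{1,2,3,\dots\}$ be a finite set, let $\omega=(\log n)_{n\in\mathbb N}$, and let $\mathcal H_\infty^J(\omega)$ be the Banach space of all Dirichlet polynomials $D(s)=\sum_{n\in J}a_n n^{-s}$, $a_n\in\mathbb C$, with the norm $\|D\|_\infty=\sup_{t\in\mathbb R}\big|\sum_{n\in J}a_n n^{-it}\big|$. Let $\pi(n)$ be the number of primes $\le n$, let $\Omega(n)$ be the number of prime factors of $n$ counted with multiplicity, and put $\pi(J)=\max_{n\in J}\pi(n)$, $\Omega(J)=\max_{n\in J}\Omega(n)$ (both $0$ if $J=\emptyset$). With $\mathfrak p_1<\mathfrak p_2<\cdots$ the sequence of primes and $\mathfrak p^\alpha=\prod_j\mathfrak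 p_j^{\alpha_j}$, put $$\Delta(J)=\{\alpha\in\mathbb N_0^{\pi(J)} : \mathfrak p^\alpha\in J\}.$$ Let $dz$ be the normalized Haar measure on the polytorus $\mathbb T^{\pi(J)}$. Then $$\lambda\big(\mathcal H_\infty^J(\omega)\big)=\int_{\mathbb T^{\pi(J)}}\Big|\sum_{\alpha\in\Delta(J)}z^\alpha\Big|\,dz .$$ Moreover, $$\frac{1}{\sqrt{2^{\Omega(J)}}}\sqrt{|J|}\ \le\ \lambda\big(\mathcal H_\infty^J(\omega)\big)\ \le\ \sqrt{|J|}.$$ -/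

import Mathlib

open MeasureTheory

universe u v

noncomputable section

/-! ## Projection constants of complex Banach spaces -/

/-- The relative projection constant `λ(X, Y)`: the infimum of `‖P‖` over all bounded projections
`P : Y → X` with `P|_X = id`, which is `∞` if there is none. -/
def relProjectionConstant {Y : Type*} [NormedAddCommGroup Y] [NormedSpace ℂ Y]
    (X : Submodule ℂ Y) : ENNReal :=
  ⨅ (P : Y →L[ℂ] X) (_ : ∀ x : X, P x = x), ENNReal.ofReal ‖P‖

/-- The absolute projection constant `λ(X)`: the supremum of `λ(I(X), Y)` over all complex Banach
spaces `Y` (in an arbitrary universe) and all linear isometric embeddings `I : X → Y` with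
`I(X)` complemented in `Y`. -/
def projectionConstant (X : Type u) [NormedAddCommGroup X] [NormedSpace ℂ X] : ENNReal :=
  ⨆ (Y : Type v) (_ : NormedAddCommGroup Y) (_ : NormedSpace ℂ Y) (_ : CompleteSpace Y)
    (I : X →ₗᵢ[ℂ] Y) (_ : (LinearMap.range I.toLinearMap).ClosedComplemented),
    relProjectionConstant (LinearMap.range I.toLinearMap)

/-! ## Dirichlet polynomials -/

/-- The `ω`-Dirichlet polynomials `s ↦ ∑ n ∈ J, a n * e ^ (-ω n * s)` supported on `J`, as a space
of functions on `ℂ`. -/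
def dirichletPolynomials (ω : ℕ → ℝ) (J : Finset ℕ) : Submodule ℂ (ℂ → ℂ) where
  carrier := {D | ∃ a : ℕ → ℂ, D = fun s ↦ ∑ n ∈ J, a n * Complex.exp (-(ω n : ℂ) * s)}
  zero_mem' := ⟨0, by ext s; simp⟩
  add_mem' := by
    rintro _ _ ⟨a, rfl⟩ ⟨b, rfl⟩
    exact ⟨a + b, by ext s; simp [add_mul, Finset.sum_add_distrib]⟩
  smul_mem' := by
    rintro c _ ⟨a, rfl⟩
    exact ⟨c • a, by ext s; simp [Finset.mul_sum, mul_assoc]⟩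

/-- The type underlying the Banach space `H_∞^J(ω)`; it gets its norm below. -/
def DirichletPolynomial (ω : ℕ → ℝ) (J : Finset ℕ) : Type := dirichletPolynomials ω J

namespace DirichletPolynomial

variable {ω : ℕ → ℝ} {J : Finset ℕ}

instance : AddCommGroup (DirichletPolynomial ω J) :=
  inferInstanceAs (AddCommGroup (dirichletPolynomials ω J))

instance : Module ℂ (DirichletPolynomial ω J) :=
  inferInstanceAs (Module ℂ (dirichletPolynomials ω J))

/-- The value `D(s)`. -/
def eval (D : DirichletPolynomial ω J) (s : ℂ) : ℂ := D.1 s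

theorem differentiable_eval (D : DirichletPolynomial ω J) : Differentiable ℂ D.eval := by
  obtain ⟨_, a, rfl⟩ := D
  change Differentiable ℂ fun s : ℂ ↦ ∑ n ∈ J, a n * Complex.exp (-(ω n : ℂ) * s)
  fun_prop

theorem bounded_eval (D : DirichletPolynomial ω J) :
    ∃ C, ∀ t : ℝ, ‖D.eval (Complex.I * t)‖ ≤ C := by
  obtain ⟨_, a, rfl⟩ := D
  refine ⟨∑ n ∈ J, ‖a n‖, fun t ↦ ?_⟩
  refine (norm_sum_le _ _).trans (Finset.sum_le_sum fun n _ ↦ ?_)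
  simp [Complex.norm_exp]

/-- Restriction to the imaginary line. -/
def restrict (ω : ℕ → ℝ) (J : Finset ℕ) :
    DirichletPolynomial ω J →ₗ[ℂ] BoundedContinuousFunction ℝ ℂ where
  toFun D := BoundedContinuousFunction.ofNormedAddCommGroup (fun t : ℝ ↦ D.eval (Complex.I * t))
    (D.differentiable_eval.continuous.comp (by fun_prop)) D.bounded_eval.choose
    D.bounded_eval.choose_spec
  map_add' _ _ := rfl
  map_smul' _ _ := rfl

theorem restrict_injective : Function.Injective (restrict ω J) := by
  rw [injective_iff_map_eq_zero]
  intro D hD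
  have h0 : ∀ t : ℝ, D.eval (Complex.I * t) = 0 := fun t ↦ DFunLike.congr_fun hD t
  have han : AnalyticOnNhd ℂ D.eval Set.univ :=
    D.differentiable_eval.differentiableOn.analyticOnNhd isOpen_univ
  have hfreq : ∃ᶠ z in nhdsWithin (0 : ℂ) {0}ᶜ, D.eval z = (0 : ℂ → ℂ) z := by
    have ht : Filter.Tendsto (fun t : ℝ ↦ Complex.I * (t : ℂ)) (nhdsWithin 0 {0}ᶜ)
        (nhdsWithin 0 {0}ᶜ) := by
      refine tendsto_nhdsWithin_iff.2 ⟨?_, ?_⟩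
      · have : Continuous fun t : ℝ ↦ Complex.I * (t : ℂ) := by fun_prop
        simpa using (this.tendsto 0).mono_left nhdsWithin_le_nhds
      · filter_upwards [self_mem_nhdsWithin] with t ht
        simpa using ht
    exact ht.frequently (Filter.Eventually.frequently (Filter.Eventually.of_forall h0))
  have := han.eq_of_frequently_eq analyticOnNhd_const hfreq
  exact Subtype.ext this

/-- The norm of `H_∞^J(ω)`: the supremum norm on the imaginary line (see `norm_eq`). -/
instance : NormedAddCommGroup (DirichletPolynomial ω J) :=
  NormedAddCommGroup.induced _ _ (restrict ω J) restrict_injective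

instance : NormedSpace ℂ (DirichletPolynomial ω J) :=
  NormedSpace.induced ℂ _ _ (restrict ω J)

theorem norm_eq (D : DirichletPolynomial ω J) :
    ‖D‖ = ⨆ t : ℝ, ‖D.eval (Complex.I * t)‖ :=
  BoundedContinuousFunction.norm_eq_iSup_norm (restrict ω J D)

end DirichletPolynomial

/-! ## The polytorus -/

instance Circle.instMeasurableSpaceBorel : MeasurableSpace Circle := borel Circle

instance Circle.instBorelSpaceBorel : BorelSpace Circle := ⟨rfl⟩

/-- The normalized Haar measure `dz` on the polytorus `𝕋^k`, as the product of the Haar probability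
measures of the circle group. -/
def polytorusHaar (k : ℕ) : Measure (Fin k → Circle) :=
  Measure.pi fun _ ↦ Measure.haarMeasure ⊤

/-! ## Index sets of natural numbers -/

/-- `π(J)`, the maximum of `π(n)` over `n ∈ J` (and `0` if `J` is empty). -/
def maxPrimeCounting (J : Finset ℕ) : ℕ := J.sup Nat.primeCounting

/-- `Ω(J)`, the maximum of `Ω(n)` over `n ∈ J` (and `0` if `J` is empty). -/
def maxCardFactors (J : Finset ℕ) : ℕ := J.sup fun n ↦ ArithmeticFunction.cardFactors n

/-- `𝔭 ^ α = ∏ 𝔭_j ^ α_j`, where `𝔭_0 < 𝔭_1 < ...` is the sequence of all primes. -/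
def primePow {k : ℕ} (α : Fin k → ℕ) : ℕ := ∏ j : Fin k, Nat.nth Nat.Prime j ^ α j

theorem finite_primePow_mem (J : Finset ℕ) :
    {α : Fin (maxPrimeCounting J) → ℕ | primePow α ∈ J}.Finite := by
  refine (Set.finite_Iic fun _ ↦ J.sup id).subset fun α hα j ↦ ?_
  have hp : ∀ i : Fin (maxPrimeCounting J), (Nat.nth Nat.Prime i).Prime :=
    fun i ↦ Nat.prime_nth_prime i
  have hle : Nat.nth Nat.Prime j ^ α j ≤ primePow α :=
    Nat.le_of_dvd (Finset.prod_pos fun i _ ↦ pow_pos (hp i).pos _)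
      (Finset.dvd_prod_of_mem _ (Finset.mem_univ j))
  exact ((Nat.lt_pow_self (hp j).one_lt).le.trans hle).trans (Finset.le_sup (f := id) hα)

/-- `Δ(J)`, the set of multi-indices `α ∈ ℕ₀^{π(J)}` with `𝔭 ^ α ∈ J`. -/
def primeExponents (J : Finset ℕ) : Finset (Fin (maxPrimeCounting J) → ℕ) :=
  (finite_primePow_mem J).toFinset

end

noncomputable section

/-! ## Characters of the polytorus -/

section Torus

variable {k : ℕ}

/-! Bohr's substitution z_j = 𝔭_j^{-s} turns Dirichlet polynomials on J into trigonometric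
polynomials on the polytorus with spectrum Δ(J). By unique factorization the numbers log 𝔭_j are
linearly independent over ℚ, so the flow t ↦ (𝔭_j^{-it})_j has dense range (`denseRange_bohrFlow`)
and the substitution preserves sup norms (`exists_bohrIsometry`).

It remains to treat the span of finitely many characters, with kernel K = ∑ z^α
(`projectionConstant_eq_integral`). From below: averaging a projection of C(𝕋^k) onto the span over
all translations does not increase its norm and produces convolution with K, of norm ∫|K|
(`integral_norm_sum_torusMonomial_le`). From above: inside any Y, point evaluations extend to Y by
Hahn–Banach, and the convolution formula then defines a projection on Y. The Haar integral is
replaced there by an average over roots of unity, so no measurable choice of extensions is needed,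
at the cost of an ε (`relProjectionConstant_range_le`).

The bound ∫|K| ≤ √|J| is Cauchy–Schwarz with orthonormality of characters. The lower bound rests on
Carleman's inequality ∑ |c_n|²/(n+1) ≤ (∫|f|)² on the circle, which comes from factoring f = gh with
|g| = |h| there. Iterated over the variables with Minkowski's inequality, it gives ∑ |c_α|²/∏(α_j+1)
≤ (∫|f|)²; for coefficients 1, ∏(α_j+1) ≤ 2^{|α|} ≤ 2^{Ω(J)} finishes the proof. -/

instance : IsProbabilityMeasure (Measure.haarMeasure (⊤ : TopologicalSpace.PositiveCompacts Circle)) :=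
  ⟨by simpa using Measure.haarMeasure_self (K₀ := (⊤ : TopologicalSpace.PositiveCompacts Circle))⟩

instance : IsProbabilityMeasure (polytorusHaar k) :=
  inferInstanceAs (IsProbabilityMeasure (Measure.pi _))

instance : (polytorusHaar k).IsMulLeftInvariant :=
  inferInstanceAs (Measure.pi _).IsMulLeftInvariant

instance : (polytorusHaar k).IsOpenPosMeasure :=
  inferInstanceAs (Measure.pi _).IsOpenPosMeasure

/-- The character `z ↦ z ^ α` of the polytorus. -/
def torusCharacter (α : Fin k → ℤ) : (Fin k → Circle) →* Circle where
  toFun z := ∏ j, z j ^ α j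
  map_one' := by simp
  map_mul' _ _ := by simp [mul_zpow, Finset.prod_mul_distrib]

theorem torusCharacter_apply (α : Fin k → ℤ) (z : Fin k → Circle) :
    torusCharacter α z = ∏ j, z j ^ α j := rfl

theorem torusCharacter_zero : torusCharacter (0 : Fin k → ℤ) = 1 := by
  ext z; simp [torusCharacter_apply]

theorem torusCharacter_add (α β : Fin k → ℤ) :
    torusCharacter (α + β) = torusCharacter α * torusCharacter β := by
  ext z; simp [torusCharacter_apply, zpow_add, Finset.prod_mul_distrib]

theorem torusCharacter_neg (α : Fin k → ℤ) : torusCharacter (-α) = (torusCharacter α)⁻¹ := by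
  ext z; simp [torusCharacter_apply]

theorem continuous_torusCharacter (α : Fin k → ℤ) : Continuous (torusCharacter α) := by
  change Continuous fun z : Fin k → Circle ↦ ∏ j, z j ^ α j
  exact continuous_finsetProd _ fun j _ ↦ (continuous_apply j).zpow _

theorem Circle.exists_zpow_ne_one {n : ℤ} (hn : n ≠ 0) : ∃ c : Circle, c ^ n ≠ 1 := by
  refine ⟨Circle.exp (Real.pi / n), fun h ↦ ?_⟩
  have : (Circle.exp (Real.pi / n)) ^ n = Circle.exp Real.pi := by
    rw [← Circle.exp_zsmul]
    congr 1
    simp only [zsmul_eq_mul]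
    field_simp
  rw [this] at h
  have h2 := congrArg (fun c : Circle ↦ (c : ℂ)) h
  simp [Circle.coe_exp, Complex.exp_pi_mul_I] at h2
  norm_num at h2

theorem exists_torusCharacter_ne_one {α : Fin k → ℤ} (hα : α ≠ 0) :
    ∃ z, torusCharacter α z ≠ 1 := by
  obtain ⟨j, hj⟩ := Function.ne_iff.1 hα
  obtain ⟨c, hc⟩ := Circle.exists_zpow_ne_one hj
  refine ⟨Pi.mulSingle j c, ?_⟩
  rw [torusCharacter_apply, Finset.prod_eq_single j]
  · simpa using hc
  · intro i _ hi
    simp [Pi.mulSingle_eq_of_ne hi]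
  · simp

/-- The character `z ↦ z ^ α` of the polytorus, as a continuous complex function. -/
def torusMonomial (α : Fin k → ℤ) : C(Fin k → Circle, ℂ) where
  toFun z := torusCharacter α z
  continuous_toFun := continuous_subtype_val.comp (continuous_torusCharacter α)

theorem torusMonomial_apply (α : Fin k → ℤ) (z : Fin k → Circle) :
    torusMonomial α z = (torusCharacter α z : ℂ) := rfl

theorem torusMonomial_natCast_apply (α : Fin k → ℕ) (z : Fin k → Circle) :
    torusMonomial (fun j ↦ (α j : ℤ)) z = ∏ j, (z j : ℂ) ^ α j := by
  rw [torusMonomial_apply, torusCharacter_apply]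
  simp only [zpow_natCast]
  exact (map_prod Circle.coeHom _ _).trans (by simp only [map_pow]; rfl)

theorem torusMonomial_map_mul (α : Fin k → ℤ) (z w : Fin k → Circle) :
    torusMonomial α (z * w) = torusMonomial α z * torusMonomial α w := by
  simp [torusMonomial_apply]

theorem torusMonomial_map_inv (α : Fin k → ℤ) (z : Fin k → Circle) :
    torusMonomial α z⁻¹ = torusMonomial (-α) z := by
  simp [torusMonomial_apply, torusCharacter_neg]

theorem torusMonomial_zero : torusMonomial (0 : Fin k → ℤ) = 1 := by
  ext z; simp [torusMonomial_apply, torusCharacter_zero]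

theorem torusMonomial_add (α β : Fin k → ℤ) :
    torusMonomial (α + β) = torusMonomial α * torusMonomial β := by
  ext z; simp [torusMonomial_apply, torusCharacter_add]

theorem star_torusMonomial (α : Fin k → ℤ) : star (torusMonomial α) = torusMonomial (-α) := by
  ext z
  simp only [ContinuousMap.star_apply, torusMonomial_apply, torusCharacter_neg, MonoidHom.inv_apply,
    Circle.coe_inv_eq_conj]
  rfl

/-- The integral of a function that is multiplied by a nontrivial factor under some translation
vanishes. -/
theorem integral_eq_zero_of_mul_left_eq_mul {G : Type*} [Group G] [MeasurableSpace G]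
    [MeasurableMul G] (μ : Measure G) [μ.IsMulLeftInvariant] {f : G → ℂ} {g : G} {c : ℂ}
    (hc : c ≠ 1) (hf : ∀ x, f (g * x) = c * f x) : ∫ x, f x ∂μ = 0 := by
  have h : ∫ x, f x ∂μ = c * ∫ x, f x ∂μ := by
    rw [← integral_const_mul, ← integral_mul_left_eq_self f g]
    simp only [hf]
  by_contra h0
  exact hc (mul_right_cancel₀ h0 (by rw [← h, one_mul]))

theorem integral_torusMonomial (α : Fin k → ℤ) :
    ∫ z, torusMonomial α z ∂polytorusHaar k = if α = 0 then 1 else 0 := by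
  split_ifs with h
  · simp [h, torusMonomial_zero]
  · obtain ⟨w, hw⟩ := exists_torusCharacter_ne_one h
    refine integral_eq_zero_of_mul_left_eq_mul _ (c := torusMonomial α w) (fun h1 ↦ hw ?_)
      fun x ↦ torusMonomial_map_mul α w x
    exact Circle.coe_injective (by simpa [torusMonomial_apply] using h1)

/-- Trigonometric polynomials are dense in the continuous functions on the polytorus. -/
theorem span_torusMonomial_closure_eq_top :
    (Submodule.span ℂ (Set.range (torusMonomial (k := k)))).topologicalClosure = ⊤ := by
  let A : StarSubalgebra ℂ C(Fin k → Circle, ℂ) :=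
    { toSubalgebra := Algebra.adjoin ℂ (Set.range torusMonomial)
      star_mem' := by
        change Algebra.adjoin ℂ (Set.range (torusMonomial (k := k))) ≤
          star (Algebra.adjoin ℂ (Set.range torusMonomial))
        refine Algebra.adjoin_le ?_
        rintro - ⟨α, rfl⟩
        exact Algebra.subset_adjoin ⟨-α, (star_torusMonomial α).symm⟩ }
  have hA : Subalgebra.toSubmodule A.toSubalgebra = Submodule.span ℂ (Set.range torusMonomial) := by
    change Subalgebra.toSubmodule (Algebra.adjoin ℂ (Set.range torusMonomial)) = _
    apply Algebra.adjoin_eq_span_of_subset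
    refine subset_trans (fun x hx ↦ ?_) Submodule.subset_span
    refine Submonoid.closure_induction (fun _ ↦ id) ⟨0, torusMonomial_zero⟩ ?_ hx
    rintro _ _ _ _ ⟨α, rfl⟩ ⟨β, rfl⟩
    exact ⟨α + β, torusMonomial_add α β⟩
  have hsep : A.SeparatesPoints := by
    intro x y hxy
    obtain ⟨j, hj⟩ := Function.ne_iff.1 hxy
    refine ⟨_, ⟨torusMonomial (Pi.single j 1), Algebra.subset_adjoin ⟨_, rfl⟩, rfl⟩, ?_⟩
    have key (z : Fin k → Circle) : torusMonomial (Pi.single j 1) z = (z j : ℂ) := by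
      rw [torusMonomial_apply, torusCharacter_apply, Finset.prod_eq_single j]
      · simp
      · intro i _ hi; simp [Pi.single_eq_of_ne hi]
      · simp
    simp only [key]
    exact fun h ↦ hj (Circle.coe_injective h)
  have := ContinuousMap.starSubalgebra_topologicalClosure_eq_top_of_separatesPoints A hsep
  rw [← hA]
  exact congr_arg (Subalgebra.toSubmodule <| StarSubalgebra.toSubalgebra ·) this

theorem ContinuousLinearMap.ext_torusMonomial {E : Type*} [NormedAddCommGroup E] [NormedSpace ℂ E]
    {L M : C(Fin k → Circle, ℂ) →L[ℂ] E} (h : ∀ α, L (torusMonomial α) = M (torusMonomial α)) :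
    L = M := by
  refine ContinuousLinearMap.ext_on (s := Set.range torusMonomial) ?_ (by rintro - ⟨α, rfl⟩; exact h α)
  exact Submodule.dense_iff_topologicalClosure_eq_top.2 span_torusMonomial_closure_eq_top

/-- Integration of continuous functions against a probability measure. -/
def ContinuousMap.integralCLM {G : Type*} [TopologicalSpace G] [CompactSpace G] [MeasurableSpace G]
    [BorelSpace G] (μ : Measure G) [IsProbabilityMeasure μ] : C(G, ℂ) →L[ℂ] ℂ :=
  LinearMap.mkContinuous
    { toFun := fun f ↦ ∫ x, f x ∂μ
      map_add' := fun f g ↦ integral_add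
        (f.continuous.integrable_of_hasCompactSupport (HasCompactSupport.of_compactSpace f))
        (g.continuous.integrable_of_hasCompactSupport (HasCompactSupport.of_compactSpace g))
      map_smul' := fun c f ↦ integral_const_mul c f } 1 fun f ↦ by
    rw [one_mul]
    refine (norm_integral_le_of_norm_le_const (C := ‖f‖)
      (Filter.Eventually.of_forall fun x ↦ f.norm_coe_le_norm x)).trans ?_
    simp

theorem ContinuousMap.integralCLM_apply {G : Type*} [TopologicalSpace G] [CompactSpace G]
    [MeasurableSpace G] [BorelSpace G] (μ : Measure G) [IsProbabilityMeasure μ] (f : C(G, ℂ)) :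
    ContinuousMap.integralCLM μ f = ∫ x, f x ∂μ := rfl

/-- A closed subgroup of the polytorus on which no nontrivial character is trivial is everything. -/
theorem eq_top_of_forall_torusCharacter_ne_one (H : Subgroup (Fin k → Circle))
    (hH : IsClosed (H : Set (Fin k → Circle)))
    (h : ∀ α : Fin k → ℤ, α ≠ 0 → ∃ z ∈ H, torusCharacter α z ≠ 1) : H = ⊤ := by
  have : CompactSpace H := isCompact_iff_compactSpace.1 hH.isCompact
  let μ : Measure H := Measure.haarMeasure ⊤
  have : IsProbabilityMeasure μ :=
    ⟨by simpa using Measure.haarMeasure_self (K₀ := (⊤ : TopologicalSpace.PositiveCompacts H))⟩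
  let r : C(Fin k → Circle, ℂ) →L[ℂ] C(H, ℂ) :=
    let φ : C(H, Fin k → Circle) := ⟨fun x ↦ x, by fun_prop⟩
    ⟨(ContinuousMap.compRightAlgHom ℂ ℂ φ).toLinearMap, ContinuousMap.continuous_precomp φ⟩
  -- On either group a character that is nontrivial there integrates to zero, so Haar measure of H,
  -- pushed to the torus, is Haar measure of the torus. The distance to H then has integral zero
  -- and, being continuous, vanishes identically.
  have key : ContinuousMap.integralCLM (polytorusHaar k) = (ContinuousMap.integralCLM μ).comp r := by
    refine ContinuousLinearMap.ext_torusMonomial fun α ↦ ?_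
    rw [ContinuousMap.integralCLM_apply, integral_torusMonomial]
    change _ = ∫ x : H, torusMonomial α x ∂μ
    split_ifs with hα
    · simp [hα, torusMonomial_zero]
    · obtain ⟨w, hwH, hw⟩ := h α hα
      refine (integral_eq_zero_of_mul_left_eq_mul _ (g := (⟨w, hwH⟩ : H)) (c := torusMonomial α w)
        (fun h1 ↦ hw ?_) fun x ↦ ?_).symm
      · exact Circle.coe_injective (by simpa [torusMonomial_apply] using h1)
      · exact torusMonomial_map_mul α w x
  have hd : Continuous fun z : Fin k → Circle ↦ Metric.infDist z (H : Set (Fin k → Circle)) :=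
    Metric.continuous_infDist_pt _
  let f : C(Fin k → Circle, ℂ) := ⟨fun z ↦ (Metric.infDist z (H : Set (Fin k → Circle)) : ℂ),
    Complex.continuous_ofReal.comp hd⟩
  have hf : ∫ z, Metric.infDist z (H : Set (Fin k → Circle)) ∂polytorusHaar k = 0 := by
    have h1 := DFunLike.congr_fun key f
    have h2 : ((ContinuousMap.integralCLM μ).comp r) f = 0 := by
      change ∫ x : H, ((Metric.infDist (x : Fin k → Circle) (H : Set (Fin k → Circle)) : ℝ) : ℂ) ∂μ = 0
      simp [Metric.infDist_zero_of_mem]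
    rw [h2, ContinuousMap.integralCLM_apply] at h1
    change ∫ z, ((Metric.infDist z (H : Set (Fin k → Circle)) : ℝ) : ℂ) ∂_ = 0 at h1
    rw [integral_complex_ofReal] at h1
    exact_mod_cast h1
  rw [integral_eq_zero_iff_of_nonneg (fun z ↦ Metric.infDist_nonneg)
    (hd.integrable_of_hasCompactSupport (HasCompactSupport.of_compactSpace _))] at hf
  have hz := (hd.ae_eq_iff_eq _ continuous_zero).1 hf
  refine eq_top_iff.2 fun z _ ↦ ?_
  exact (hH.mem_iff_infDist_zero ⟨1, H.one_mem⟩).2 (congrFun hz z)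

end Torus

/-! ## Averages over roots of unity -/

section Mean

variable {k : ℕ}

/-- The point of the polytorus whose coordinates are the `(N + 1)`-st roots of unity indexed by
`w`. -/
def rootPoint {N : ℕ} (w : Fin k → ZMod (N + 1)) : Fin k → Circle := fun j ↦ ZMod.toCircle (w j)

theorem rootPoint_add {N : ℕ} (v w : Fin k → ZMod (N + 1)) :
    rootPoint (v + w) = rootPoint v * rootPoint w := by
  ext j; simp [rootPoint, AddChar.map_add_eq_mul]

/-- The average of `f` over the points `z * w⁻¹`, where `w` runs through the vectors of
`(N + 1)`-st roots of unity. -/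
def rootMean (N : ℕ) (z : Fin k → Circle) : C(Fin k → Circle, ℂ) →ₗ[ℂ] ℂ where
  toFun f := (Fintype.card (Fin k → ZMod (N + 1)) : ℂ)⁻¹ *
    ∑ w : Fin k → ZMod (N + 1), f (z * (rootPoint w)⁻¹)
  map_add' f g := by simp [Finset.sum_add_distrib, mul_add]
  map_smul' c f := by simp [← Finset.mul_sum, mul_left_comm]

theorem rootMean_apply (N : ℕ) (z : Fin k → Circle) (f : C(Fin k → Circle, ℂ)) :
    rootMean N z f = (Fintype.card (Fin k → ZMod (N + 1)) : ℂ)⁻¹ *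
      ∑ w : Fin k → ZMod (N + 1), f (z * (rootPoint w)⁻¹) := rfl

theorem norm_rootMean_le (N : ℕ) (z : Fin k → Circle) (f : C(Fin k → Circle, ℂ)) :
    ‖rootMean N z f‖ ≤ ‖f‖ := by
  rw [rootMean_apply, norm_mul, norm_inv, Complex.norm_natCast, inv_mul_le_iff₀
    (by exact_mod_cast Fintype.card_pos)]
  refine (norm_sum_le_of_le _ fun w _ ↦ f.norm_coe_le_norm _).trans ?_
  simp

/-- Shifting the summation index by the generator in coordinate j multiplies the sum by a root of
unity, which differs from 1 because 0 < |α j| < N + 1 prevents N + 1 from dividing α j. -/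
theorem rootMean_torusMonomial_eq_zero {N : ℕ} (z : Fin k → Circle) {α : Fin k → ℤ} {j : Fin k}
    (h0 : α j ≠ 0) (hj : |α j| < N + 1) : rootMean N z (torusMonomial α) = 0 := by
  rw [rootMean_apply]
  refine mul_eq_zero_of_right _ ?_
  let v : Fin k → ZMod (N + 1) := Pi.single j 1
  have h1 : torusMonomial α (rootPoint v)⁻¹ ≠ 1 := by
    intro h
    have h2 : torusCharacter α (rootPoint v) = 1 := by
      rw [torusMonomial_apply, map_inv] at h
      exact inv_eq_one.1 (Circle.coe_injective h)
    rw [torusCharacter_apply, Finset.prod_eq_single j] at h2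
    · have h3 : ZMod.toCircle ((α j : ZMod (N + 1))) = 1 := by
        rw [← h2, rootPoint, ← AddChar.map_zsmul_eq_zpow]
        simp [v]
      have h4 := ZMod.injective_toCircle (h3.trans (AddChar.map_zero_eq_one _).symm)
      rw [ZMod.intCast_zmod_eq_zero_iff_dvd] at h4
      exact h0 (Int.eq_zero_of_abs_lt_dvd h4 (by exact_mod_cast hj))
    · intro i _ hi; simp [rootPoint, v, Pi.single_eq_of_ne hi]
    · simp
  have h2 : ∑ w : Fin k → ZMod (N + 1), torusMonomial α (z * (rootPoint w)⁻¹) =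
      torusMonomial α (rootPoint v)⁻¹ *
        ∑ w : Fin k → ZMod (N + 1), torusMonomial α (z * (rootPoint w)⁻¹) := by
    rw [Finset.mul_sum, ← Equiv.sum_comp (Equiv.addLeft v)]
    refine Finset.sum_congr rfl fun w _ ↦ ?_
    rw [← torusMonomial_map_mul, Equiv.coe_addLeft, rootPoint_add, mul_inv, mul_left_comm]
  by_contra h
  exact h1 (mul_right_cancel₀ h (by rw [← h2, one_mul]))

theorem eventually_rootMean_torusMonomial (α : Fin k → ℤ) :
    ∀ᶠ N : ℕ in Filter.atTop, ∀ z, rootMean N z (torusMonomial α) = if α = 0 then 1 else 0 := by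
  split_ifs with h
  · refine Filter.Eventually.of_forall fun N z ↦ ?_
    have : (Fintype.card (Fin k → ZMod (N + 1)) : ℂ) ≠ 0 := Nat.cast_ne_zero.2 Fintype.card_ne_zero
    rw [rootMean_apply, h, torusMonomial_zero]
    simp only [ContinuousMap.one_apply, Finset.sum_const, Finset.card_univ, nsmul_eq_mul, mul_one]
    exact inv_mul_cancel₀ this
  · obtain ⟨j, hj⟩ := Function.ne_iff.1 h
    filter_upwards [Filter.eventually_ge_atTop (α j).natAbs] with N hN z
    exact rootMean_torusMonomial_eq_zero z hj (by zify at hN; omega)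

/-- On a fixed trigonometric polynomial the averages are eventually exact for all z at once. Density
and the norm bound 1 for both functionals carry this over to f. Uniformity in z is what an operator
norm estimate requires. -/
theorem eventually_norm_rootMean_sub_integral_le (f : C(Fin k → Circle, ℂ)) {ε : ℝ} (hε : 0 < ε) :
    ∀ᶠ N : ℕ in Filter.atTop, ∀ z, ‖rootMean N z f - ∫ x, f x ∂polytorusHaar k‖ ≤ ε := by
  have hq : ∀ q ∈ Submodule.span ℂ (Set.range (torusMonomial (k := k))),
      ∀ᶠ N : ℕ in Filter.atTop, ∀ z,
        rootMean N z q = ContinuousMap.integralCLM (polytorusHaar k) q := by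
    intro q hq
    induction hq using Submodule.span_induction with
    | mem x hx =>
      obtain ⟨α, rfl⟩ := hx
      filter_upwards [eventually_rootMean_torusMonomial α] with N hN z
      rw [hN, ContinuousMap.integralCLM_apply, integral_torusMonomial]
    | zero => simp
    | add x y _ _ hx hy => filter_upwards [hx, hy] with N h1 h2 z; rw [map_add, map_add, h1, h2]
    | smul c x _ hx => filter_upwards [hx] with N h1 z; rw [map_smul, map_smul, h1]
  have hd : f ∈ closure (Submodule.span ℂ (Set.range (torusMonomial (k := k))) : Set _) := by
    have := span_torusMonomial_closure_eq_top (k := k)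
    rw [← Submodule.topologicalClosure_coe, this]; trivial
  obtain ⟨q, hqs, hfq⟩ := Metric.mem_closure_iff.1 hd (ε / 2) (half_pos hε)
  filter_upwards [hq q hqs] with N hN z
  rw [← ContinuousMap.integralCLM_apply]
  have h1 : rootMean N z f - ContinuousMap.integralCLM (polytorusHaar k) f =
      rootMean N z (f - q) - ContinuousMap.integralCLM (polytorusHaar k) (f - q) := by
    rw [map_sub, map_sub, hN]; ring
  have h2 : ‖ContinuousMap.integralCLM (polytorusHaar k) (f - q)‖ ≤ ‖f - q‖ := by
    refine (norm_integral_le_of_norm_le_const (C := ‖f - q‖)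
      (Filter.Eventually.of_forall fun x ↦ (f - q).norm_coe_le_norm x)).trans ?_
    simp
  rw [h1]
  rw [dist_eq_norm] at hfq
  linarith [norm_sub_le (rootMean N z (f - q)) (ContinuousMap.integralCLM (polytorusHaar k) (f - q)),
    norm_rootMean_le N z (f - q)]

end Mean

/-! ## The projection constant of a space of trigonometric polynomials -/

section Projection

variable {k : ℕ}

/-- Rudin's averaging argument: the translation average of Q acts on characters as the indicator of
s, hence is convolution with K. Only its value at the identity is needed, which is a functional L
with ‖L‖ ≤ ‖Q‖ and L f = ∫ conj(K) f. -/
theorem integral_norm_sum_torusMonomial_le (s : Finset (Fin k → ℤ))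
    (Q : C(Fin k → Circle, ℂ) →L[ℂ] C(Fin k → Circle, ℂ))
    (hQ : ∀ α ∈ s, Q (torusMonomial α) = torusMonomial α)
    (hr : ∀ f, Q f ∈ Submodule.span ℂ (torusMonomial '' (s : Set (Fin k → ℤ)))) :
    ∫ z, ‖∑ α ∈ s, torusMonomial α z‖ ∂polytorusHaar k ≤ ‖Q‖ := by
  let K : C(Fin k → Circle, ℂ) := ∑ α ∈ s, torusMonomial α
  have hK (z) : ∑ α ∈ s, torusMonomial α z = K z := by simp [K]
  let tr (f : C(Fin k → Circle, ℂ)) : C(Fin k → Circle, C(Fin k → Circle, ℂ)) :=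
    -- Currying makes z ↦ tr f z continuous for the sup norm, so the integrand below is continuous.
    ContinuousMap.curry ⟨fun p ↦ f (p.1 * p.2), by fun_prop⟩
  have htr (f z w) : tr f z w = f (z * w) := rfl
  have hcont (f) : Continuous fun z ↦ Q (tr f z) z⁻¹ := by fun_prop
  have hint (f) : Integrable (fun z ↦ Q (tr f z) z⁻¹) (polytorusHaar k) :=
    (hcont f).integrable_of_hasCompactSupport (HasCompactSupport.of_compactSpace _)
  have hnorm (f z) : ‖Q (tr f z) z⁻¹‖ ≤ ‖Q‖ * ‖f‖ := by
    refine ((Q (tr f z)).norm_coe_le_norm _).trans ((Q.le_opNorm _).trans ?_)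
    gcongr
    exact (ContinuousMap.norm_le _ (norm_nonneg f)).2 fun w ↦ f.norm_coe_le_norm _
  -- Conjugating Q by translation by z and evaluating at 1 gives Q (tr f z) z⁻¹.
  let L : C(Fin k → Circle, ℂ) →L[ℂ] ℂ := LinearMap.mkContinuous
    { toFun := fun f ↦ ∫ z, Q (tr f z) z⁻¹ ∂polytorusHaar k
      map_add' := fun f g ↦ by
        rw [← integral_add (hint f) (hint g)]
        congr 1 with z
        have : tr (f + g) z = tr f z + tr g z := rfl
        rw [this, map_add, ContinuousMap.add_apply]
      map_smul' := fun c f ↦ by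
        rw [RingHom.id_apply, smul_eq_mul, ← integral_const_mul]
        congr 1 with z
        have : tr (c • f) z = c • tr f z := rfl
        rw [this, map_smul, ContinuousMap.smul_apply, smul_eq_mul] } ‖Q‖ fun f ↦ by
    refine (norm_integral_le_of_norm_le_const (C := ‖Q‖ * ‖f‖)
      (Filter.Eventually.of_forall (hnorm f))).trans ?_
    simp
  have hLnorm (f) : ‖L f‖ ≤ ‖Q‖ * ‖f‖ :=
    (L.le_opNorm f).trans (by gcongr; exact LinearMap.mkContinuous_norm_le _ (norm_nonneg _) _)
  have hchar (β) : L (torusMonomial β) =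
      ∫ z, torusMonomial β z * Q (torusMonomial β) z⁻¹ ∂polytorusHaar k := by
    change ∫ z, Q (tr (torusMonomial β) z) z⁻¹ ∂polytorusHaar k = _
    congr 1 with z
    have : tr (torusMonomial β) z = torusMonomial β z • torusMonomial β := by
      ext w; exact torusMonomial_map_mul β z w
    rw [this, map_smul, ContinuousMap.smul_apply, smul_eq_mul]
  have hLM : L = (ContinuousMap.integralCLM (polytorusHaar k)).comp
      (ContinuousLinearMap.mul ℂ _ (star K)) := by
    refine ContinuousLinearMap.ext_torusMonomial fun β ↦ ?_
    have hM : (ContinuousMap.integralCLM (polytorusHaar k)).comp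
        (ContinuousLinearMap.mul ℂ _ (star K)) (torusMonomial β) = if β ∈ s then 1 else 0 := by
      have : ContinuousLinearMap.mul ℂ C(Fin k → Circle, ℂ) (star K) (torusMonomial β) =
          ∑ α ∈ s, torusMonomial (-α + β) := by
        simp [K, star_torusMonomial, torusMonomial_add]
      rw [ContinuousLinearMap.comp_apply, this, map_sum]
      simp [ContinuousMap.integralCLM_apply, integral_torusMonomial, neg_add_eq_zero]
    rw [hM, hchar]
    split_ifs with hβ
    · rw [hQ β hβ]
      simp [torusMonomial_apply]
    -- The integral extracts the β-coefficient of g, which is zero because the spectrum of g lies in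
    -- s and β does not.
    · have h0 : ∀ g ∈ Submodule.span ℂ (torusMonomial '' (s : Set (Fin k → ℤ))),
          ∫ z, torusMonomial β z * g z⁻¹ ∂polytorusHaar k = 0 := by
        intro g hg
        have hi (g : C(Fin k → Circle, ℂ)) :
            Integrable (fun z ↦ torusMonomial β z * g z⁻¹) (polytorusHaar k) :=
          Continuous.integrable_of_hasCompactSupport (by fun_prop)
            (HasCompactSupport.of_compactSpace _)
        induction hg using Submodule.span_induction with
        | mem x hx =>
          obtain ⟨α, hα, rfl⟩ := hx
          have (z : Fin k → Circle) : torusMonomial β z * torusMonomial α z⁻¹ = torusMonomial (β + -α) z := by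
            rw [torusMonomial_map_inv, torusMonomial_add, ContinuousMap.mul_apply]
          simp only [this]
          rw [integral_torusMonomial, if_neg]
          rw [← sub_eq_add_neg, sub_eq_zero]
          rintro rfl
          exact hβ hα
        | zero => simp
        | add x y _ _ hx hy =>
          simp only [ContinuousMap.add_apply, mul_add]
          rw [integral_add (hi x) (hi y), hx, hy, add_zero]
        | smul c x _ hx =>
          simp only [ContinuousMap.smul_apply, smul_eq_mul, mul_left_comm _ c]
          rw [integral_const_mul, hx, mul_zero]
      exact h0 _ (hr _)
  simp only [hK]
  refine le_of_forall_pos_le_add fun ε hε ↦ ?_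
  have hpos (z) : 0 < ‖K z‖ + ε := by positivity
  have hne (z) : ((‖K z‖ + ε : ℝ) : ℂ) ≠ 0 := Complex.ofReal_ne_zero.2 (hpos z).ne'
  -- K/|K| would show ‖L‖ ≥ ∫|K| but need not be continuous at zeros of K; adding ε to the
  -- denominator costs at most ε, since |K|² ≥ (|K| - ε)(|K| + ε).
  let f : C(Fin k → Circle, ℂ) := ⟨fun z ↦ K z / ((‖K z‖ + ε : ℝ) : ℂ),
    K.continuous.div (by fun_prop) hne⟩
  have hf : ‖f‖ ≤ 1 := by
    refine (ContinuousMap.norm_le _ zero_le_one).2 fun z ↦ ?_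
    change ‖K z / ((‖K z‖ + ε : ℝ) : ℂ)‖ ≤ 1
    rw [norm_div, Complex.norm_of_nonneg (hpos z).le, div_le_one (hpos z)]
    linarith
  have hLf : L f = ((∫ z, ‖K z‖ ^ 2 / (‖K z‖ + ε) ∂polytorusHaar k : ℝ) : ℂ) := by
    rw [hLM, ← integral_complex_ofReal]
    change ∫ z, (starRingEnd ℂ (K z)) * (K z / ((‖K z‖ + ε : ℝ) : ℂ)) ∂_ = _
    congr 1 with z
    rw [← mul_div_assoc, Complex.conj_mul']
    push_cast
    rfl
  have h1 : ∫ z, ‖K z‖ ^ 2 / (‖K z‖ + ε) ∂polytorusHaar k ≤ ‖Q‖ := by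
    have h2 := hLnorm f
    rw [hLf, Complex.norm_real] at h2
    refine (le_abs_self _).trans (h2.trans ?_)
    exact mul_le_of_le_one_right (norm_nonneg _) hf
  have hc2 : Continuous fun z ↦ ‖K z‖ ^ 2 / (‖K z‖ + ε) :=
    Continuous.div (by fun_prop) (by fun_prop) fun z ↦ (hpos z).ne'
  have h3 : ∫ z, (‖K z‖ - ε) ∂polytorusHaar k ≤
      ∫ z, ‖K z‖ ^ 2 / (‖K z‖ + ε) ∂polytorusHaar k := by
    refine integral_mono
      (Continuous.integrable_of_hasCompactSupport (by fun_prop) (HasCompactSupport.of_compactSpace _))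
      (hc2.integrable_of_hasCompactSupport (HasCompactSupport.of_compactSpace _)) fun z ↦ ?_
    rw [le_div_iff₀ (hpos z)]
    nlinarith [sq_nonneg ε]
  rw [integral_sub
    (Continuous.integrable_of_hasCompactSupport (by fun_prop) (HasCompactSupport.of_compactSpace _))
    (integrable_const _)] at h3
  simp at h3
  linarith

variable {X : Type*} [NormedAddCommGroup X] [NormedSpace ℂ X]

/-- Hahn–Banach for evaluation at w, transported to the range of I, where it has norm at most 1
because both embeddings are isometric. -/
theorem exists_extension_eval (U : X →ₗᵢ[ℂ] C(Fin k → Circle, ℂ)) {Y : Type*}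
    [NormedAddCommGroup Y] [NormedSpace ℂ Y] (I : X →ₗᵢ[ℂ] Y) (w : Fin k → Circle) :
    ∃ φ : Y →L[ℂ] ℂ, (∀ x, φ (I x) = U x w) ∧ ‖φ‖ ≤ 1 := by
  let f : LinearMap.range I.toLinearMap →L[ℂ] ℂ :=
    LinearMap.mkContinuous ((ContinuousMap.evalCLM ℂ w).toLinearMap ∘ₗ U.toLinearMap ∘ₗ
      (LinearEquiv.ofInjective I.toLinearMap I.injective).symm.toLinearMap) 1 fun y ↦ by
      obtain ⟨x, rfl⟩ := (LinearEquiv.ofInjective I.toLinearMap I.injective).surjective y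
      simp only [LinearMap.comp_apply, LinearEquiv.coe_coe, LinearEquiv.symm_apply_apply, one_mul]
      refine ((U x).norm_coe_le_norm w).trans ?_
      rw [U.norm_map]
      exact (I.norm_map x).ge
  obtain ⟨g, hg, hgn⟩ := exists_extension_norm_eq _ f
  refine ⟨g, fun x ↦ ?_, hgn.le.trans (LinearMap.mkContinuous_norm_le _ zero_le_one _)⟩
  have h := hg (LinearEquiv.ofInjective I.toLinearMap I.injective x)
  refine h.trans ?_
  simp only [f, LinearMap.mkContinuous_apply, LinearMap.comp_apply, LinearEquiv.coe_coe,
    LinearEquiv.symm_apply_apply]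
  rfl

/-- The α-coefficient of y is taken to be the discrete Fourier coefficient of w ↦ φ_w(y), where φ_w
extends evaluation at w. The resulting function at z is the average of φ_w(y) K(z w⁻¹), bounded by
‖y‖ times an average of |K| that tends to ∫|K| uniformly in z. -/
theorem relProjectionConstant_range_le (U : X →ₗᵢ[ℂ] C(Fin k → Circle, ℂ))
    (s : Finset (Fin k → ℤ)) (e : (Fin k → ℤ) → X) (he : ∀ α ∈ s, U (e α) = torusMonomial α)
    (hspan : Submodule.span ℂ (e '' s) = ⊤) {Y : Type*} [NormedAddCommGroup Y] [NormedSpace ℂ Y]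
    (I : X →ₗᵢ[ℂ] Y) : relProjectionConstant (LinearMap.range I.toLinearMap) ≤
      ENNReal.ofReal (∫ z, ‖∑ α ∈ s, torusMonomial α z‖ ∂polytorusHaar k) := by
  let K : C(Fin k → Circle, ℂ) := ∑ α ∈ s, torusMonomial α
  have hK (z) : ∑ α ∈ s, torusMonomial α z = K z := by simp [K]
  simp only [hK]
  have hK0 : 0 ≤ ∫ z, ‖K z‖ ∂polytorusHaar k := integral_nonneg fun _ ↦ norm_nonneg _
  let K' : C(Fin k → Circle, ℂ) := ⟨fun z ↦ (‖K z‖ : ℂ), by fun_prop⟩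
  refine ENNReal.le_of_forall_pos_le_add fun ε hε _ ↦ ?_
  have hε' : (0 : ℝ) < ε := hε
  -- Discrete orthogonality is needed only for the finitely many differences of elements of s, so it
  -- holds exactly for large N and P is a genuine projection.
  have hev : ∀ᶠ N : ℕ in Filter.atTop, ∀ α ∈ s, ∀ β ∈ s,
      rootMean N 1 (torusMonomial (α + -β)) = if α + -β = 0 then 1 else 0 := by
    refine (Filter.eventually_all_finset _).2 fun α _ ↦ (Filter.eventually_all_finset _).2
      fun β _ ↦ ?_
    filter_upwards [eventually_rootMean_torusMonomial (α + -β)] with N hN using hN 1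
  obtain ⟨N, hN, hNK⟩ := (hev.and (eventually_norm_rootMean_sub_integral_le K' hε')).exists
  set C : ℂ := (Fintype.card (Fin k → ZMod (N + 1)) : ℂ)⁻¹ with hC
  choose φ hφ hφn using exists_extension_eval U I
  let c (α : Fin k → ℤ) : Y →L[ℂ] ℂ :=
    C • ∑ w : Fin k → ZMod (N + 1), torusMonomial α (rootPoint w)⁻¹ • φ (rootPoint w)
  have hc (α y) : c α y =
      C * ∑ w : Fin k → ZMod (N + 1), torusMonomial α (rootPoint w)⁻¹ * φ (rootPoint w) y := by
    simp [c]
  let P : Y →L[ℂ] LinearMap.range I.toLinearMap :=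
    ∑ α ∈ s, (c α).smulRight (⟨I (e α), e α, rfl⟩ : LinearMap.range I.toLinearMap)
  have hP (y) : (P y : Y) = I (∑ α ∈ s, c α y • e α) := by simp [P]
  have hPid (x : LinearMap.range I.toLinearMap) : P x = x := by
    obtain ⟨_, x, rfl⟩ := x
    have hx : x ∈ Submodule.span ℂ (e '' s) := hspan ▸ Submodule.mem_top
    apply Subtype.ext
    change (P (I x) : Y) = I x
    induction hx using Submodule.span_induction with
    | mem x hx =>
      obtain ⟨β, hβ, rfl⟩ := hx
      rw [hP]
      congr 1
      rw [Finset.sum_eq_single β]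
      · have : c β (I (e β)) = rootMean N 1 (torusMonomial (β + -β)) := by
          rw [hc, rootMean_apply]
          congr 1
          refine Finset.sum_congr rfl fun w _ ↦ ?_
          rw [hφ, he β hβ, one_mul, torusMonomial_add, ContinuousMap.mul_apply,
            ← torusMonomial_map_inv β, inv_inv]
        rw [this, hN β hβ β hβ]
        simp
      · intro α hα hαβ
        have : c α (I (e β)) = rootMean N 1 (torusMonomial (α + -β)) := by
          rw [hc, rootMean_apply]
          congr 1
          refine Finset.sum_congr rfl fun w _ ↦ ?_
          rw [hφ, he β hβ, one_mul, torusMonomial_add, ContinuousMap.mul_apply,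
            ← torusMonomial_map_inv β, inv_inv]
        rw [this, hN α hα β hβ, if_neg, zero_smul]
        rwa [← sub_eq_add_neg, sub_eq_zero]
      · exact fun h ↦ (h hβ).elim
    | zero => simp
    | add x y _ _ hx hy => simp only [map_add, Submodule.coe_add, hx, hy]
    | smul a x _ hx => simp only [map_smul, Submodule.coe_smul, hx]
  have hPn : ‖P‖ ≤ ∫ z, ‖K z‖ ∂polytorusHaar k + ε := by
    refine P.opNorm_le_bound (by positivity) fun y ↦ ?_
    change ‖(P y : Y)‖ ≤ _
    rw [hP, I.norm_map, ← U.norm_map]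
    refine (ContinuousMap.norm_le _ (by positivity)).2 fun z ↦ ?_
    have h1 : U (∑ α ∈ s, c α y • e α) z = C * ∑ w : Fin k → ZMod (N + 1),
        φ (rootPoint w) y * K (z * (rootPoint w)⁻¹) := by
      have h2 : U (∑ α ∈ s, c α y • e α) = ∑ α ∈ s, c α y • torusMonomial α := by
        rw [map_sum]
        exact Finset.sum_congr rfl fun α hα ↦ by rw [map_smul, he α hα]
      rw [h2]
      simp only [ContinuousMap.sum_apply, ContinuousMap.smul_apply, smul_eq_mul, hc, K,
        torusMonomial_map_mul, Finset.mul_sum, Finset.sum_mul]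
      rw [Finset.sum_comm]
      refine Finset.sum_congr rfl fun w _ ↦ Finset.sum_congr rfl fun α _ ↦ by ring
    have h3 : ‖U (∑ α ∈ s, c α y • e α) z‖ ≤ ‖y‖ * ‖rootMean N z K'‖ := by
      have h4 : rootMean N z K' = ((‖C‖ * ∑ w : Fin k → ZMod (N + 1),
          ‖K (z * (rootPoint w)⁻¹)‖ : ℝ) : ℂ) := by
        rw [rootMean_apply, hC, norm_inv, Complex.norm_natCast]
        push_cast
        rfl
      rw [h1, h4, Complex.norm_of_nonneg (by positivity), norm_mul, mul_left_comm ‖y‖,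
        Finset.mul_sum]
      gcongr
      refine norm_sum_le_of_le _ fun w _ ↦ ?_
      rw [norm_mul]
      gcongr
      exact (φ _).le_of_opNorm_le (hφn _) y |>.trans (one_mul _).le
    refine h3.trans ?_
    rw [mul_comm]
    gcongr
    have h5 := hNK z
    have h6 : ∫ x, K' x ∂polytorusHaar k = ((∫ z, ‖K z‖ ∂polytorusHaar k : ℝ) : ℂ) :=
      integral_complex_ofReal
    rw [h6] at h5
    calc ‖rootMean N z K'‖ ≤ ‖((∫ z, ‖K z‖ ∂polytorusHaar k : ℝ) : ℂ)‖ +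
          ‖rootMean N z K' - ((∫ z, ‖K z‖ ∂polytorusHaar k : ℝ) : ℂ)‖ := norm_le_norm_add_norm_sub' _ _
      _ ≤ _ := by rw [Complex.norm_of_nonneg hK0]; gcongr
  calc relProjectionConstant (LinearMap.range I.toLinearMap) ≤ ENNReal.ofReal ‖P‖ :=
        iInf₂_le P hPid
    _ ≤ ENNReal.ofReal (∫ z, ‖K z‖ ∂polytorusHaar k + ε) := ENNReal.ofReal_le_ofReal hPn
    _ = _ := by rw [ENNReal.ofReal_add hK0 hε'.le, ENNReal.ofReal_coe_nnreal]

end Projection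

/-- The projection constant of a space of trigonometric polynomials on the polytorus with given
spectrum is the `L¹`-norm of its reproducing kernel. -/
theorem projectionConstant_eq_integral {k : ℕ} {X : Type u} [NormedAddCommGroup X]
    [NormedSpace ℂ X] (U : X →ₗᵢ[ℂ] C(Fin k → Circle, ℂ))
    (s : Finset (Fin k → ℤ)) (e : (Fin k → ℤ) → X) (he : ∀ α ∈ s, U (e α) = torusMonomial α)
    (hspan : Submodule.span ℂ (e '' s) = ⊤) :
    projectionConstant.{u, v} X =
      ENNReal.ofReal (∫ z, ‖∑ α ∈ s, torusMonomial α z‖ ∂polytorusHaar k) := by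
  apply le_antisymm
  · refine iSup_le fun Y ↦ iSup_le fun _ ↦ iSup_le fun _ ↦ iSup_le fun _ ↦ iSup_le fun I ↦
      iSup_le fun _ ↦ relProjectionConstant_range_le U s e he hspan I
  -- The supremum is already attained in the space of continuous functions on the torus, lifted to
  -- the universe of Y. Finite dimension of X makes the range complemented there.
  · let ι : C(Fin k → Circle, ℂ) ≃ₗᵢ[ℂ] ULift.{v} C(Fin k → Circle, ℂ) :=
      (LinearIsometryEquiv.ulift ℂ _).symm
    let I : X →ₗᵢ[ℂ] ULift.{v} C(Fin k → Circle, ℂ) := ι.toLinearIsometry.comp U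
    have hfin : FiniteDimensional ℂ X :=
      ⟨⟨_, hspan ▸ Submodule.fg_span (s.finite_toSet.image e) |>.choose_spec⟩⟩
    refine le_trans ?_ (le_iSup_of_le (ULift.{v} C(Fin k → Circle, ℂ)) <| le_iSup_of_le _ <|
      le_iSup_of_le _ <| le_iSup_of_le inferInstance <| le_iSup_of_le I <| le_iSup_of_le
      (Submodule.ClosedComplemented.of_finiteDimensional _) le_rfl)
    refine le_iInf₂ fun P hP ↦ ENNReal.ofReal_le_ofReal ?_
    let Q : C(Fin k → Circle, ℂ) →L[ℂ] C(Fin k → Circle, ℂ) :=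
      ι.symm.toContinuousLinearEquiv.toContinuousLinearMap ∘L
        (LinearMap.range I.toLinearMap).subtypeL ∘L P ∘L
        ι.toContinuousLinearEquiv.toContinuousLinearMap
    have hQ (f) : Q f = ι.symm (P (ι f)) := rfl
    refine (integral_norm_sum_torusMonomial_le s Q (fun α hα ↦ ?_) fun f ↦ ?_).trans ?_
    · have h := hP ⟨I (e α), e α, rfl⟩
      have h2 : ι (torusMonomial α) = I (e α) := by rw [← he α hα]; rfl
      have h3 : ((P (I (e α)) : LinearMap.range I.toLinearMap) : ULift.{v} C(Fin k → Circle, ℂ)) =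
        I (e α) := congrArg Subtype.val h
      rw [hQ, h2, h3, ← h2, ι.symm_apply_apply]
    · obtain ⟨x, hx⟩ := (P (ι f)).2
      have h1 : Q f = U x := by
        rw [hQ, ← hx]; exact ι.symm_apply_apply _
      have h2 : x ∈ Submodule.span ℂ (e '' s) := hspan ▸ Submodule.mem_top
      have h3 := Submodule.mem_map_of_mem (f := U.toLinearMap) h2
      rw [Submodule.map_span, ← Set.image_comp] at h3
      have h4 : torusMonomial '' (s : Set (Fin k → ℤ)) = (U.toLinearMap ∘ e) '' s :=
        Set.image_congr fun α hα ↦ (he α hα).symm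
      rw [h1, h4]
      exact h3
    · refine Q.opNorm_le_bound (norm_nonneg P) fun f ↦ ?_
      rw [hQ, ι.symm.norm_map]
      exact (P.le_opNorm _).trans (by rw [ι.norm_map])

/-! ## Bohr's correspondence -/

section Bohr

theorem factorization_primePow {k : ℕ} (α : Fin k → ℕ) (j : Fin k) :
    (primePow α).factorization (Nat.nth Nat.Prime j) = α j := by
  have hp (i : Fin k) : (Nat.nth Nat.Prime i).Prime := Nat.prime_nth_prime i
  rw [primePow, Nat.factorization_prod fun i _ ↦ pow_ne_zero _ (hp i).ne_zero, Finsupp.finsetSum_apply,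
    Finset.sum_eq_single j]
  · rw [(hp j).factorization_pow, Finsupp.single_eq_same]
  · intro i _ hij
    rw [(hp i).factorization_pow, Finsupp.single_apply, if_neg]
    exact fun h ↦ hij (Fin.ext (Nat.nth_injective Nat.infinite_setOfPred_prime h))
  · simp

theorem primePow_injective {k : ℕ} : Function.Injective (primePow (k := k)) := fun α β h ↦ by
  ext j; rw [← factorization_primePow α, h, factorization_primePow]

theorem primePow_ne_zero {k : ℕ} (α : Fin k → ℕ) : primePow α ≠ 0 :=
  Finset.prod_ne_zero_iff.2 fun i _ ↦ pow_ne_zero _ (Nat.prime_nth_prime i).ne_zero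

/-- The exponents of the first `k` primes in `n`. -/
def primeExponent (k n : ℕ) (j : Fin k) : ℕ := n.factorization (Nat.nth Nat.Prime j)

/-- A prime dividing n is at most n, so its index among the primes is below π(n) ≤ k: no prime
factor is lost by keeping k exponents. -/
theorem primePow_primeExponent {k n : ℕ} (hn : n ≠ 0) (hk : n.primeCounting ≤ k) :
    primePow (primeExponent k n) = n := by
  refine Nat.eq_of_factorization_eq (primePow_ne_zero _) hn fun p ↦ ?_
  by_cases hp : p.Prime
  · by_cases hpk : p.primeCounting' < k
    · have h : Nat.nth Nat.Prime (⟨p.primeCounting', hpk⟩ : Fin k) = p := Nat.nth_count hp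
      have := factorization_primePow (primeExponent k n) ⟨p.primeCounting', hpk⟩
      rwa [primeExponent, h] at this
    · have h0 : n.factorization p = 0 := by
        refine Nat.factorization_eq_zero_of_not_dvd fun hd ↦ hpk ?_
        refine lt_of_lt_of_le ?_ hk
        exact (Nat.count_strict_mono hp (Nat.lt_succ_of_le (Nat.le_of_dvd hn.bot_lt hd)) :)
      rw [h0]
      refine Nat.factorization_eq_zero_of_not_dvd fun hd ↦ hpk ?_
      obtain ⟨i, -, hi⟩ := (hp.prime.dvd_finsetProd_iff _).1 hd
      have := (Nat.prime_dvd_prime_iff_eq hp (Nat.prime_nth_prime i)).1 (hp.dvd_of_dvd_pow hi)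
      rw [this, Nat.primeCounting', Nat.count_nth_of_infinite Nat.infinite_setOfPred_prime]
      exact i.2
  · rw [Nat.factorization_eq_zero_of_not_prime _ hp, Nat.factorization_eq_zero_of_not_prime _ hp]

theorem log_primePow {k : ℕ} (α : Fin k → ℕ) :
    Real.log (primePow α) = ∑ j, α j * Real.log (Nat.nth Nat.Prime j) := by
  rw [primePow, Nat.cast_prod, Real.log_prod fun i _ ↦ by
    exact_mod_cast pow_ne_zero _ (Nat.prime_nth_prime i).ne_zero]
  simp

/-- Separating positive and negative exponents, a vanishing combination equates the logarithms of
two integers, and unique factorization makes the two parts of α coincide. This is the arithmetic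
input to Kronecker's theorem. -/
theorem sum_mul_log_prime_ne_zero {k : ℕ} {α : Fin k → ℤ} (hα : α ≠ 0) :
    ∑ j, (α j : ℝ) * Real.log (Nat.nth Nat.Prime j) ≠ 0 := by
  intro h
  refine hα ?_
  have h1 : Real.log (primePow fun j ↦ (α j).toNat) = Real.log (primePow fun j ↦ (-α j).toNat) := by
    rw [log_primePow, log_primePow, ← sub_eq_zero, ← Finset.sum_sub_distrib, ← h]
    refine Finset.sum_congr rfl fun j _ ↦ ?_
    rw [← sub_mul]
    congr 1
    exact_mod_cast Int.toNat_sub_toNat_neg (α j)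
  have h2 := Real.log_injOn_pos (Set.mem_Ioi.2 (by exact_mod_cast (primePow_ne_zero _).bot_lt))
    (Set.mem_Ioi.2 (by exact_mod_cast (primePow_ne_zero _).bot_lt)) h1
  have h3 := primePow_injective (Nat.cast_injective h2)
  ext j
  have := congrFun h3 j
  simp only [Pi.zero_apply]
  omega

/-- The Kronecker flow `t ↦ (𝔭_j ^ (-it))_j` on the polytorus. -/
def bohrFlow (k : ℕ) : Multiplicative ℝ →* (Fin k → Circle) where
  toFun t j := Circle.exp (-(t.toAdd * Real.log (Nat.nth Nat.Prime j)))
  map_one' := by ext j; simp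
  map_mul' s t := by
    funext j
    simp only [toAdd_mul, Pi.mul_apply, ← Circle.exp_add]
    congr 1
    ring

theorem torusCharacter_bohrFlow {k : ℕ} (α : Fin k → ℤ) (t : Multiplicative ℝ) :
    torusCharacter α (bohrFlow k t) =
      Circle.exp (-(t.toAdd * ∑ j, (α j : ℝ) * Real.log (Nat.nth Nat.Prime j))) := by
  have h (s : Finset (Fin k)) (f : Fin k → ℝ) :
      Circle.exp (∑ j ∈ s, f j) = ∏ j ∈ s, Circle.exp (f j) := by
    classical
    induction s using Finset.induction_on with
    | empty => simp
    | insert a s ha ih => rw [Finset.sum_insert ha, Finset.prod_insert ha, Circle.exp_add, ih]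
  rw [torusCharacter_apply, Finset.mul_sum, ← Finset.sum_neg_distrib, h]
  refine Finset.prod_congr rfl fun j _ ↦ ?_
  change Circle.exp _ ^ α j = _
  rw [← Circle.exp_zsmul, zsmul_eq_mul]
  congr 1
  ring

/-- Kronecker's theorem for the logarithms of the primes. -/
theorem denseRange_bohrFlow (k : ℕ) : DenseRange (bohrFlow k) := by
  have h := eq_top_of_forall_torusCharacter_ne_one (bohrFlow k).range.topologicalClosure
    (Subgroup.isClosed_topologicalClosure _) fun α hα ↦ by
      have hc := sum_mul_log_prime_ne_zero hα
      -- The time is chosen so that the character takes the value e^{iπ} = -1.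
      refine ⟨bohrFlow k (Multiplicative.ofAdd
          (-(Real.pi / ∑ j, (α j : ℝ) * Real.log (Nat.nth Nat.Prime j)))),
        Subgroup.le_topologicalClosure _ ⟨_, rfl⟩, fun h ↦ ?_⟩
      rw [torusCharacter_bohrFlow, toAdd_ofAdd, neg_mul, neg_neg, div_mul_cancel₀ _ hc] at h
      have h2 := congrArg (fun c : Circle ↦ (c : ℂ)) h
      simp only [Circle.coe_exp, Complex.exp_pi_mul_I, Circle.coe_one] at h2
      norm_num at h2
  intro z
  have hz : z ∈ (bohrFlow k).range.topologicalClosure := h ▸ Subgroup.mem_top z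
  exact hz

end Bohr

/-! ### Monomials spanning the Dirichlet polynomials -/

namespace DirichletPolynomial

variable {ω : ℕ → ℝ} {J : Finset ℕ}

/-- The Dirichlet polynomial `e ^ (-ω n s)` if `n ∈ J`, and `0` otherwise. -/
def single (ω : ℕ → ℝ) (J : Finset ℕ) (n : ℕ) : DirichletPolynomial ω J :=
  ⟨fun s ↦ ∑ m ∈ J, (Pi.single n 1 : ℕ → ℂ) m * Complex.exp (-(ω m : ℂ) * s), _, rfl⟩

theorem eval_single {n : ℕ} (hn : n ∈ J) (s : ℂ) :
    (single ω J n).eval s = Complex.exp (-(ω n : ℂ) * s) := by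
  change ∑ m ∈ J, (Pi.single n 1 : ℕ → ℂ) m * Complex.exp (-(ω m : ℂ) * s) = _
  rw [Finset.sum_eq_single n]
  · simp
  · intro m _ hm; simp [Pi.single_eq_of_ne hm]
  · exact fun h ↦ (h hn).elim

/-- Evaluation at a point, as a linear map. -/
def evalLM (s : ℂ) : DirichletPolynomial ω J →ₗ[ℂ] ℂ where
  toFun D := D.eval s
  map_add' _ _ := rfl
  map_smul' _ _ := rfl

theorem exists_eq_sum_single (D : DirichletPolynomial ω J) :
    ∃ a : ℕ → ℂ, D = ∑ n ∈ J, a n • single ω J n := by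
  obtain ⟨f, a, rfl⟩ := D
  refine ⟨a, Subtype.ext (funext fun s ↦ ?_)⟩
  change _ = evalLM s (∑ n ∈ J, a n • single ω J n)
  rw [map_sum]
  refine Finset.sum_congr rfl fun n hn ↦ ?_
  rw [map_smul]
  exact congrArg (a n * ·) (eval_single hn s).symm

end DirichletPolynomial

/-! ### The isometry onto polynomials with spectrum Δ(J) -/

section

variable {J : Finset ℕ}

theorem primePow_primeExponent_of_mem (hJ : 0 ∉ J) {n : ℕ} (hn : n ∈ J) :
    primePow (primeExponent (maxPrimeCounting J) n) = n :=
  primePow_primeExponent (fun h ↦ hJ (h ▸ hn)) (Finset.le_sup (f := Nat.primeCounting) hn)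

theorem injOn_primeExponent (hJ : 0 ∉ J) :
    Set.InjOn (primeExponent (maxPrimeCounting J)) J := fun m hm n hn h ↦ by
  rw [← primePow_primeExponent_of_mem hJ hm, h, primePow_primeExponent_of_mem hJ hn]

theorem primeExponents_eq_image (hJ : 0 ∉ J) :
    primeExponents J = J.image (primeExponent (maxPrimeCounting J)) := by
  ext α
  simp only [primeExponents, Set.Finite.mem_toFinset, Set.mem_ofPred_eq, Finset.mem_image]
  constructor
  · exact fun h ↦ ⟨_, h, primePow_injective (primePow_primeExponent_of_mem hJ h)⟩
  · rintro ⟨n, hn, rfl⟩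
    rwa [primePow_primeExponent_of_mem hJ hn]

theorem card_primeExponents (hJ : 0 ∉ J) : (primeExponents J).card = J.card := by
  rw [primeExponents_eq_image hJ, Finset.card_image_of_injOn (injOn_primeExponent hJ)]

theorem eval_single_log (hJ : 0 ∉ J) {n : ℕ} (hn : n ∈ J) (t : ℝ) :
    (DirichletPolynomial.single (fun n ↦ Real.log n) J n).eval (Complex.I * t) =
      torusMonomial (fun j ↦ (primeExponent (maxPrimeCounting J) n j : ℤ))
        (bohrFlow _ (Multiplicative.ofAdd t)) := by
  have h := log_primePow (primeExponent (maxPrimeCounting J) n)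
  rw [primePow_primeExponent_of_mem hJ hn] at h
  rw [DirichletPolynomial.eval_single hn, torusMonomial_apply, torusCharacter_bohrFlow]
  simp only [Int.cast_natCast]
  rw [← h, Circle.coe_exp, toAdd_ofAdd]
  congr 1
  push_cast
  ring

/-- Bohr's correspondence: `𝔭 ^ (-α s) ↦ z ^ α` is an isometry. -/
theorem norm_sum_single_eq (hJ : 0 ∉ J) (a : ℕ → ℂ) :
    ‖∑ n ∈ J, a n • DirichletPolynomial.single (fun n ↦ Real.log n) J n‖ =
      ‖∑ n ∈ J, a n •
        torusMonomial (fun j ↦ (primeExponent (maxPrimeCounting J) n j : ℤ))‖ := by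
  set D := ∑ n ∈ J, a n • DirichletPolynomial.single (fun n ↦ Real.log n) J n
  set f := ∑ n ∈ J, a n • torusMonomial (fun j ↦ (primeExponent (maxPrimeCounting J) n j : ℤ))
  have hDf (t : ℝ) : D.eval (Complex.I * t) = f (bohrFlow _ (Multiplicative.ofAdd t)) := by
    change DirichletPolynomial.evalLM _ D = _
    simp only [D, f, map_sum, map_smul, ContinuousMap.sum_apply, ContinuousMap.smul_apply]
    refine Finset.sum_congr rfl fun n hn ↦ ?_
    rw [← eval_single_log hJ hn]
    rfl
  rw [DirichletPolynomial.norm_eq]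
  simp only [hDf]
  have hb : BddAbove (Set.range fun t : ℝ ↦ ‖f (bohrFlow _ (Multiplicative.ofAdd t))‖) :=
    ⟨‖f‖, by rintro - ⟨t, rfl⟩; exact f.norm_coe_le_norm _⟩
  refine le_antisymm (ciSup_le fun t ↦ f.norm_coe_le_norm _) ?_
  refine (ContinuousMap.norm_le _ (Real.iSup_nonneg fun _ ↦ norm_nonneg _)).2 fun z ↦ ?_
  refine (denseRange_bohrFlow _).induction_on z
    (isClosed_le f.continuous.norm continuous_const) fun t ↦ ?_
  exact le_ciSup hb t.toAdd

/-- Both spaces are parametrized by coefficient vectors, with equal norms. Fourier coefficients show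
that the torus side is injective; equality of norms passes this to the Dirichlet side, so
coefficients are well defined and U can be read off from them. -/
theorem exists_bohrIsometry (hJ : 0 ∉ J) :
    ∃ (U : DirichletPolynomial (fun n ↦ Real.log n) J →ₗᵢ[ℂ]
        C(Fin (maxPrimeCounting J) → Circle, ℂ))
      (e : (Fin (maxPrimeCounting J) → ℤ) → DirichletPolynomial (fun n ↦ Real.log n) J),
      (∀ α ∈ (primeExponents J).image fun α j ↦ (α j : ℤ), U (e α) = torusMonomial α) ∧
      Submodule.span ℂ (e '' ((primeExponents J).image fun α j ↦ (α j : ℤ))) = ⊤ := by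
  let k := maxPrimeCounting J
  let X := DirichletPolynomial (fun n ↦ Real.log n) J
  let sg (n : ℕ) : X := DirichletPolynomial.single (fun n ↦ Real.log n) J n
  let χ (n : ℕ) : C(Fin k → Circle, ℂ) := torusMonomial fun j ↦ (primeExponent k n j : ℤ)
  let Φ : (J → ℂ) →ₗ[ℂ] X := Fintype.linearCombination ℂ fun n ↦ sg n
  let Ψ : (J → ℂ) →ₗ[ℂ] C(Fin k → Circle, ℂ) := Fintype.linearCombination ℂ fun n ↦ χ n
  have hΦ (a : ℕ → ℂ) : Φ (fun n ↦ a n) = ∑ n ∈ J, a n • sg n := by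
    simp only [Φ, Fintype.linearCombination_apply]
    exact Finset.sum_coe_sort J fun n ↦ a n • sg n
  have hΨ (a : ℕ → ℂ) : Ψ (fun n ↦ a n) = ∑ n ∈ J, a n • χ n := by
    simp only [Ψ, Fintype.linearCombination_apply]
    exact Finset.sum_coe_sort J fun n ↦ a n • χ n
  have hnorm (a : J → ℂ) : ‖Φ a‖ = ‖Ψ a‖ := by
    let b (n : ℕ) : ℂ := if h : n ∈ J then a ⟨n, h⟩ else 0
    have hb : a = fun n : J ↦ b n := by ext n; simp [b]
    rw [hb, hΦ, hΨ]
    exact norm_sum_single_eq hJ b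
  have hΨinj : Function.Injective Ψ := by
    refine (injective_iff_map_eq_zero Ψ).2 fun a ha ↦ funext fun m ↦ ?_
    have h1 : ContinuousMap.integralCLM (polytorusHaar k) (star (χ m) * Ψ a) = a m := by
      simp only [Ψ, χ, Fintype.linearCombination_apply, Finset.mul_sum, map_sum, mul_smul_comm,
        map_smul, star_torusMonomial, ← torusMonomial_add, ContinuousMap.integralCLM_apply,
        integral_torusMonomial, neg_add_eq_zero]
      rw [Finset.sum_eq_single m]
      · simp
      · intro n _ hnm
        rw [if_neg, smul_zero]
        intro h
        refine hnm (Subtype.ext (injOn_primeExponent hJ n.2 m.2 (funext fun j ↦ ?_)))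
        exact_mod_cast (congrFun h j).symm
      · simp
    rw [← h1, ha, mul_zero, map_zero, Pi.zero_apply]
  have hΦinj : Function.Injective Φ := by
    refine (injective_iff_map_eq_zero Φ).2 fun a ha ↦ ?_
    have : ‖Ψ a‖ = 0 := by rw [← hnorm, ha, norm_zero]
    exact (injective_iff_map_eq_zero Ψ).1 hΨinj a (norm_eq_zero.1 this)
  have hΦsurj : Function.Surjective Φ := fun D ↦ by
    obtain ⟨a, rfl⟩ := D.exists_eq_sum_single
    exact ⟨_, hΦ a⟩
  let E := LinearEquiv.ofBijective Φ ⟨hΦinj, hΦsurj⟩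
  let U : X →ₗᵢ[ℂ] C(Fin k → Circle, ℂ) :=
    { toLinearMap := Ψ ∘ₗ E.symm.toLinearMap
      norm_map' := fun D ↦ by
        obtain ⟨a, rfl⟩ := E.surjective D
        change ‖Ψ (E.symm (E a))‖ = ‖Φ a‖
        rw [E.symm_apply_apply, hnorm] }
  have hU {n : ℕ} (hn : n ∈ J) : U (sg n) = χ n := by
    have h1 : sg n = E (Pi.single ⟨n, hn⟩ 1) := by
      change _ = Φ _
      simp [Φ]
    change Ψ (E.symm (sg n)) = _
    rw [h1, E.symm_apply_apply]
    simp [Ψ]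
  -- The value of e at exponents with negative entries is irrelevant, as the spectrum consists of
  -- nonnegative ones.
  refine ⟨U, fun α ↦ sg (primePow fun j ↦ (α j).toNat), ?_, ?_⟩
  · simp only [primeExponents_eq_image hJ, Finset.mem_image]
    rintro - ⟨-, ⟨n, hn, rfl⟩, rfl⟩
    simp only [Int.toNat_natCast]
    rw [primePow_primeExponent_of_mem hJ hn, hU hn]
  · refine eq_top_iff.2 fun D _ ↦ ?_
    obtain ⟨a, rfl⟩ := D.exists_eq_sum_single
    refine Submodule.sum_mem _ fun n hn ↦ Submodule.smul_mem _ _ (Submodule.subset_span ?_)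
    refine ⟨fun j ↦ (primeExponent k n j : ℤ), ?_, ?_⟩
    · simp only [primeExponents_eq_image hJ, Finset.coe_image]
      exact ⟨_, ⟨n, hn, rfl⟩, rfl⟩
    · simp only [Int.toNat_natCast]
      rw [primePow_primeExponent_of_mem hJ hn]

theorem projectionConstant_dirichletPolynomial (hJ : 0 ∉ J) :
    projectionConstant.{0, v} (DirichletPolynomial (fun n ↦ Real.log n) J) =
      ENNReal.ofReal (∫ z : Fin (maxPrimeCounting J) → Circle,
        ‖∑ α ∈ primeExponents J, ∏ j, (z j : ℂ) ^ α j‖ ∂(polytorusHaar (maxPrimeCounting J))) := by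
  obtain ⟨U, e, he, hspan⟩ := exists_bohrIsometry hJ
  rw [projectionConstant_eq_integral U _ e he hspan]
  congr 2 with z
  rw [Finset.sum_image fun α _ β _ h ↦ funext fun j ↦ by exact_mod_cast congrFun h j]
  simp only [torusMonomial_natCast_apply]

end

/-! ## Bessel's inequality and Fourier coefficients on the circle -/

/-- Bessel's inequality for continuous functions. -/
theorem ContinuousMap.sum_norm_sq_integralCLM_le {G ι : Type*} [TopologicalSpace G]
    [CompactSpace G] [MeasurableSpace G] [BorelSpace G] [DecidableEq ι] (μ : Measure G)
    [IsProbabilityMeasure μ] (e : ι → C(G, ℂ))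
    (he : ∀ i j, integralCLM μ (star (e i) * e j) = if i = j then 1 else 0) (s : Finset ι)
    (f : C(G, ℂ)) :
    ∑ i ∈ s, ‖integralCLM μ (star (e i) * f)‖ ^ 2 ≤ ∫ x, ‖f x‖ ^ 2 ∂μ := by
  set b : ι → ℂ := fun i ↦ integralCLM μ (star (e i) * f) with hb
  set h : C(G, ℂ) := f - ∑ i ∈ s, b i • e i with hh
  have hstar (f : C(G, ℂ)) : integralCLM μ (star f) = star (integralCLM μ f) := integral_conj
  have h0 (i) (hi : i ∈ s) : integralCLM μ (star (e i) * h) = 0 := by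
    rw [hh, mul_sub, map_sub, Finset.mul_sum, map_sum]
    simp only [mul_smul_comm, map_smul, he, smul_eq_mul, mul_ite, mul_one, mul_zero]
    rw [Finset.sum_ite_eq, if_pos hi, sub_self]
  have h1 (i) : integralCLM μ (star f * e i) = star (b i) := by
    rw [hb, ← hstar, star_mul, star_star]
  have h2 : integralCLM μ (star h * h) = integralCLM μ (star f * f) - ∑ i ∈ s, b i * star (b i) := by
    have : star h = star f - ∑ i ∈ s, star (b i) • star (e i) := by simp [hh]
    rw [this, sub_mul, map_sub, Finset.sum_mul, map_sum]
    simp only [smul_mul_assoc, map_smul]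
    rw [Finset.sum_congr rfl fun i hi ↦ by rw [h0 i hi, smul_zero], Finset.sum_const_zero, sub_zero,
      hh, mul_sub, map_sub, Finset.mul_sum, map_sum]
    simp only [mul_smul_comm, map_smul, h1, smul_eq_mul]
  have h3 (f : C(G, ℂ)) : integralCLM μ (star f * f) = ((∫ x, ‖f x‖ ^ 2 ∂μ : ℝ) : ℂ) := by
    rw [← integral_complex_ofReal]
    change ∫ x, (starRingEnd ℂ) (f x) * f x ∂μ = _
    congr 1 with x
    rw [Complex.conj_mul']
    push_cast
    rfl
  have h4 : ∑ i ∈ s, b i * star (b i) = ((∑ i ∈ s, ‖b i‖ ^ 2 : ℝ) : ℂ) := by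
    push_cast
    exact Finset.sum_congr rfl fun i _ ↦ Complex.mul_conj' _
  rw [h3, h3, h4] at h2
  have h5 : ∫ x, ‖h x‖ ^ 2 ∂μ = ∫ x, ‖f x‖ ^ 2 ∂μ - ∑ i ∈ s, ‖b i‖ ^ 2 := by exact_mod_cast h2
  have h6 : 0 ≤ ∫ x, ‖h x‖ ^ 2 ∂μ := integral_nonneg fun _ ↦ by positivity
  linarith

section Circle

/-- The normalized Haar measure on the circle. -/
def circleHaar : Measure Circle := Measure.haarMeasure ⊤

instance : IsProbabilityMeasure circleHaar :=
  inferInstanceAs (IsProbabilityMeasure (Measure.haarMeasure ⊤))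

instance : circleHaar.IsMulLeftInvariant :=
  inferInstanceAs (Measure.haarMeasure ⊤).IsMulLeftInvariant

/-- The function `z ↦ z ^ n` on the circle. -/
def circleMonomial (n : ℕ) : C(Circle, ℂ) := ⟨fun z ↦ (z : ℂ) ^ n, by fun_prop⟩

theorem integral_circleMonomial (m n : ℕ) :
    ContinuousMap.integralCLM circleHaar (star (circleMonomial m) * circleMonomial n) =
      if m = n then 1 else 0 := by
  have h (z : Circle) : (star (circleMonomial m) * circleMonomial n) z =
      ((z ^ ((n : ℤ) - m) : Circle) : ℂ) := by
    change (starRingEnd ℂ) ((z : ℂ) ^ m) * (z : ℂ) ^ n = _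
    rw [zpow_sub]
    simp only [zpow_natCast, Circle.coe_mul, Circle.coe_inv_eq_conj, Circle.coe_pow]
    rw [mul_comm]
  rw [ContinuousMap.integralCLM_apply]
  simp only [h]
  split_ifs with hmn
  · simp [hmn]
  · obtain ⟨c, hc⟩ := Circle.exists_zpow_ne_one (n := (n : ℤ) - m) (by omega)
    refine integral_eq_zero_of_mul_left_eq_mul _ (g := c) (c := ((c ^ ((n : ℤ) - m) : Circle) : ℂ))
      (fun h ↦ hc (Circle.coe_injective (by simpa using h))) fun x ↦ ?_
    rw [mul_zpow, Circle.coe_mul]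

/-- The Fourier coefficients of an analytic function are its Taylor coefficients. -/
theorem integral_mul_circleMonomial_eq {g : ℂ → ℂ} {R : ℝ} (hR : 1 < R)
    (hg : DifferentiableOn ℂ g (Metric.ball 0 R)) (f : C(Circle, ℂ)) (hf : ∀ z : Circle, f z = g z)
    (n : ℕ) : ContinuousMap.integralCLM circleHaar (star (circleMonomial n) * f) =
      (n.factorial : ℂ)⁻¹ * iteratedDeriv n g 0 := by
  have hsum (z : ℂ) (hz : ‖z‖ = 1) := Complex.hasSum_taylorSeries_on_ball (r := R) hg
    (show z ∈ Metric.ball 0 R by simpa [hz] using hR)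
  set b : ℕ → ℂ := fun n ↦ (n.factorial : ℂ)⁻¹ * iteratedDeriv n g 0 with hb
  -- Since R > 1, the Taylor series converges absolutely at z = 1, hence uniformly on the circle,
  -- and may be integrated term by term.
  have hbs : Summable fun n ↦ ‖b n‖ := by
    have := (hsum 1 norm_one).summable
    simp only [sub_zero, one_pow, smul_eq_mul, one_mul] at this
    exact this.norm
  have hnorm (n) : ‖circleMonomial n‖ ≤ 1 :=
    (ContinuousMap.norm_le _ zero_le_one).2 fun z ↦ by simp [circleMonomial, Circle.norm_coe]
  have hs : Summable fun n ↦ b n • circleMonomial n := by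
    refine Summable.of_norm_bounded hbs fun n ↦ ?_
    rw [norm_smul]
    exact mul_le_of_le_one_right (norm_nonneg _) (hnorm n)
  have hfs : HasSum (fun n ↦ b n • circleMonomial n) f := by
    convert hs.hasSum
    ext z
    have h1 : HasSum (fun n ↦ b n * (z : ℂ) ^ n) ((∑' n, b n • circleMonomial n) z) :=
      (ContinuousMap.evalCLM ℂ z).hasSum hs.hasSum
    have h2 := hsum z (Circle.norm_coe z)
    rw [hf]
    refine HasSum.unique h2 ?_
    simp only [sub_zero, smul_eq_mul]
    simpa only [hb, mul_comm, mul_left_comm, mul_assoc] using h1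
  have h3 := ((ContinuousMap.integralCLM circleHaar).comp
    (ContinuousLinearMap.mul ℂ _ (star (circleMonomial n)))).hasSum hfs
  refine HasSum.unique h3 ?_
  have h4 (m : ℕ) : ((ContinuousMap.integralCLM circleHaar).comp
      (ContinuousLinearMap.mul ℂ _ (star (circleMonomial n)))) (b m • circleMonomial m) =
      if m = n then b n else 0 := by
    rw [map_smul, ContinuousLinearMap.comp_apply, ContinuousLinearMap.mul_apply',
      integral_circleMonomial]
    by_cases h : m = n
    · simp [h]
    · simp [h, Ne.symm h]
  simp only [h4]
  exact hasSum_ite_eq n (b n)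

end Circle

/-! ## Carleman's inequality -/

section Carleman

/-- `f` is analytic near the closed unit disc and is a product of two such functions of the same
modulus on the unit circle. -/
def HasBalancedFactorization (f : ℂ → ℂ) : Prop :=
  ∃ R > 1, ∃ g h : ℂ → ℂ, DifferentiableOn ℂ g (Metric.ball 0 R) ∧
    DifferentiableOn ℂ h (Metric.ball 0 R) ∧ (∀ z ∈ Metric.ball 0 R, f z = g z * h z) ∧
    ∀ z, ‖z‖ = 1 → ‖g z‖ = ‖h z‖

theorem sq_cpow_half (x : ℂ) : x ^ (2⁻¹ : ℂ) * x ^ (2⁻¹ : ℂ) = x := by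
  rw [← sq]
  exact_mod_cast Complex.cpow_nat_inv_pow x two_ne_zero

theorem hasBalancedFactorization_const (c : ℂ) : HasBalancedFactorization fun _ ↦ c :=
  ⟨2, one_lt_two, fun _ ↦ c ^ (2⁻¹ : ℂ), fun _ ↦ c ^ (2⁻¹ : ℂ), differentiableOn_const _,
    differentiableOn_const _, fun _ _ ↦ (sq_cpow_half c).symm, fun _ _ ↦ rfl⟩

theorem HasBalancedFactorization.mul {f₁ f₂ : ℂ → ℂ} (h₁ : HasBalancedFactorization f₁)
    (h₂ : HasBalancedFactorization f₂) : HasBalancedFactorization fun z ↦ f₁ z * f₂ z := by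
  obtain ⟨R, hR, g, h, hg, hh, hf, hn⟩ := h₁
  obtain ⟨R', hR', g', h', hg', hh', hf', hn'⟩ := h₂
  have l := Metric.ball_subset_ball (x := (0 : ℂ)) (min_le_left R R')
  have r := Metric.ball_subset_ball (x := (0 : ℂ)) (min_le_right R R')
  refine ⟨min R R', lt_min hR hR', fun z ↦ g z * g' z, fun z ↦ h z * h' z,
    (hg.mono l).mul (hg'.mono r), (hh.mono l).mul (hh'.mono r), fun z hz ↦ ?_, fun z hz ↦ ?_⟩
  · change f₁ z * f₂ z = g z * g' z * (h z * h' z)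
    rw [hf z (l hz), hf' z (r hz)]; ring
  · change ‖g z * g' z‖ = ‖h z * h' z‖
    rw [norm_mul, norm_mul, hn z hz, hn' z hz]

/-- On this ball 1 - ρz stays within distance less than 1 of the point 1, where the principal square
root is analytic. -/
theorem differentiableOn_one_sub_mul_cpow_half {ρ : ℂ} {R : ℝ} (h : ‖ρ‖ * R ≤ 1) :
    DifferentiableOn ℂ (fun z ↦ (1 - ρ * z) ^ (2⁻¹ : ℂ)) (Metric.ball 0 R) ∧
      ∀ z ∈ Metric.ball (0 : ℂ) R, 1 - ρ * z ≠ 0 := by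
  have hs (z : ℂ) (hz : z ∈ Metric.ball (0 : ℂ) R) : 1 - ρ * z ∈ Complex.slitPlane := by
    rw [sub_eq_add_neg]
    refine Complex.mem_slitPlane_of_norm_lt_one ?_
    rw [norm_neg, norm_mul]
    rw [mem_ball_zero_iff] at hz
    rcases (norm_nonneg ρ).eq_or_lt with h0 | h0
    · rw [← h0]; simp
    · exact (mul_lt_mul_of_pos_left hz h0).trans_le h
  refine ⟨fun z hz ↦ ?_, fun z hz ↦ Complex.slitPlane_ne_zero (hs z hz)⟩
  refine DifferentiableAt.differentiableWithinAt ?_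
  exact DifferentiableAt.cpow_const (by fun_prop) (hs z hz)

/-- For |ρ| < 1, on the circle |z - ρ| = |1 - conj(ρ) z|, so h = (1 - conj(ρ) z)^{1/2} and g = (z -
ρ)/h have equal modulus. For |ρ| > 1 there is no zero in the disc and g = h is a square root of -ρ(1
- z/ρ). -/
theorem hasBalancedFactorization_sub {ρ : ℂ} (hρ : ‖ρ‖ ≠ 1) :
    HasBalancedFactorization fun z ↦ z - ρ := by
  rcases hρ.lt_or_gt with hρ | hρ
  -- A radius above 1 with ‖ρ‖R ≤ 1 that also makes sense for ρ = 0.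
  · have hR : 1 < 2 / (1 + ‖ρ‖) := by rw [lt_div_iff₀ (by positivity)]; linarith
    obtain ⟨hd, h0⟩ := differentiableOn_one_sub_mul_cpow_half (ρ := (starRingEnd ℂ) ρ)
      (R := 2 / (1 + ‖ρ‖)) (by
        rw [RCLike.norm_conj, ← mul_div_assoc, div_le_one (by positivity)]; linarith)
    have hne (z) (hz : z ∈ Metric.ball (0 : ℂ) (2 / (1 + ‖ρ‖))) :
        (1 - (starRingEnd ℂ) ρ * z) ^ (2⁻¹ : ℂ) ≠ 0 := fun h ↦ by
      have := sq_cpow_half (1 - (starRingEnd ℂ) ρ * z)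
      rw [h, mul_zero] at this
      exact h0 z hz this.symm
    refine ⟨2 / (1 + ‖ρ‖), hR, fun z ↦ (z - ρ) / (1 - (starRingEnd ℂ) ρ * z) ^ (2⁻¹ : ℂ),
      fun z ↦ (1 - (starRingEnd ℂ) ρ * z) ^ (2⁻¹ : ℂ), ?_, hd, ?_, ?_⟩
    · exact DifferentiableOn.div (by fun_prop) hd hne
    · exact fun z hz ↦ (div_mul_cancel₀ _ (hne z hz)).symm
    · intro z hz
      have hzb : z ∈ Metric.ball (0 : ℂ) (2 / (1 + ‖ρ‖)) := by simpa [hz] using hR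
      rw [norm_div, div_eq_iff (norm_ne_zero_iff.2 (hne z hzb)), ← norm_mul, sq_cpow_half]
      have h1 : z * (starRingEnd ℂ) z = 1 := by rw [Complex.mul_conj', hz]; simp
      have h2 : z - ρ = z * (starRingEnd ℂ) (1 - (starRingEnd ℂ) ρ * z) := by
        rw [map_sub, map_mul, map_one, Complex.conj_conj]
        linear_combination ρ * h1
      rw [h2, norm_mul, hz, one_mul, RCLike.norm_conj]
  · have h0 : ρ ≠ 0 := fun h ↦ by rw [h, norm_zero] at hρ; linarith
    obtain ⟨hd, -⟩ := differentiableOn_one_sub_mul_cpow_half (ρ := ρ⁻¹) (R := ‖ρ‖) (by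
      rw [norm_inv, inv_mul_cancel₀ (norm_ne_zero_iff.2 h0)])
    refine ⟨‖ρ‖, hρ, fun z ↦ (-ρ) ^ (2⁻¹ : ℂ) * (1 - ρ⁻¹ * z) ^ (2⁻¹ : ℂ),
      fun z ↦ (-ρ) ^ (2⁻¹ : ℂ) * (1 - ρ⁻¹ * z) ^ (2⁻¹ : ℂ), hd.const_mul _, hd.const_mul _,
      fun z _ ↦ ?_, fun _ _ ↦ rfl⟩
    rw [mul_mul_mul_comm, sq_cpow_half, sq_cpow_half]
    field_simp
    ring

theorem Polynomial.hasBalancedFactorization (p : Polynomial ℂ) {s : ℂ} (hs : s ≠ 0)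
    (hp : ∀ ρ ∈ p.roots, ‖ρ‖ ≠ ‖s‖) : HasBalancedFactorization fun z ↦ p.eval (s * z) := by
  have key : ∀ m : Multiset ℂ, (∀ ρ ∈ m, ‖ρ‖ ≠ ‖s‖) →
      HasBalancedFactorization fun z ↦ (m.map fun ρ ↦ s * z - ρ).prod := by
    intro m hm
    induction m using Multiset.induction_on with
    | empty => simpa using hasBalancedFactorization_const 1
    | cons ρ m ih =>
      simp only [Multiset.map_cons, Multiset.prod_cons]
      refine HasBalancedFactorization.mul ?_ (ih fun ρ' h ↦ hm ρ' (Multiset.mem_cons_of_mem h))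
      have h1 : (fun z ↦ s * z - ρ) = fun z ↦ s * (z - ρ / s) := by
        ext z; field_simp
      rw [h1]
      refine (hasBalancedFactorization_const s).mul (hasBalancedFactorization_sub ?_)
      rw [norm_div, Ne, div_eq_one_iff_eq (norm_ne_zero_iff.2 hs)]
      exact hm ρ (Multiset.mem_cons_self _ _)
  convert (hasBalancedFactorization_const p.leadingCoeff).mul (key p.roots hp) using 2 with z
  conv_lhs => rw [(IsAlgClosed.splits p).eq_prod_roots]
  simp [Polynomial.eval_multiset_prod]

/-- On the circle |F| = |G|² = |H|², so Bessel bounds the squared coefficients of both factors by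
∫|F|. The n-th coefficient of F is a Cauchy product with n + 1 terms, and Cauchy–Schwarz on it costs
exactly the weight n + 1. -/
theorem HasBalancedFactorization.sum_norm_sq_le {f : ℂ → ℂ} (hf : HasBalancedFactorization f)
    (F : C(Circle, ℂ)) (hF : ∀ z : Circle, F z = f z) (N : ℕ) :
    ∑ n ∈ Finset.range N, ‖ContinuousMap.integralCLM circleHaar (star (circleMonomial n) * F)‖ ^ 2 /
      (n + 1) ≤ (∫ z, ‖F z‖ ∂circleHaar) ^ 2 := by
  obtain ⟨R, hR, g, h, hg, hh, hfgh, hn⟩ := hf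
  have hball : ∀ z : Circle, (z : ℂ) ∈ Metric.ball (0 : ℂ) R := fun z ↦ by
    simpa [Circle.norm_coe] using hR
  have h0 : (0 : ℂ) ∈ Metric.ball (0 : ℂ) R := by simpa using zero_lt_one.trans hR
  let G : C(Circle, ℂ) := ⟨fun z ↦ g z, hg.continuousOn.comp_continuous (by fun_prop) hball⟩
  let H : C(Circle, ℂ) := ⟨fun z ↦ h z, hh.continuousOn.comp_continuous (by fun_prop) hball⟩
  have hFGH (z) : F z = G z * H z := (hF z).trans (hfgh z (hball z))
  have hGH (z) : ‖G z‖ = ‖H z‖ := hn z (Circle.norm_coe z)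
  set b : ℕ → ℂ := fun n ↦ (n.factorial : ℂ)⁻¹ * iteratedDeriv n g 0 with hb
  set c : ℕ → ℂ := fun n ↦ (n.factorial : ℂ)⁻¹ * iteratedDeriv n h 0 with hc
  have hG (n) := integral_mul_circleMonomial_eq hR hg G (fun _ ↦ rfl) n
  have hH (n) := integral_mul_circleMonomial_eq hR hh H (fun _ ↦ rfl) n
  have hFc (n : ℕ) : ContinuousMap.integralCLM circleHaar (star (circleMonomial n) * F) =
      ∑ i ∈ Finset.range (n + 1), b i * c (n - i) := by
    rw [integral_mul_circleMonomial_eq hR (hg.mul hh) F hFGH n, iteratedDeriv_mul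
      ((hg.analyticAt (Metric.isOpen_ball.mem_nhds h0)).contDiffAt)
      ((hh.analyticAt (Metric.isOpen_ball.mem_nhds h0)).contDiffAt), Finset.mul_sum]
    refine Finset.sum_congr rfl fun i hi ↦ ?_
    have hi' : i ≤ n := Nat.lt_succ_iff.1 (Finset.mem_range.1 hi)
    rw [Nat.cast_choose ℂ hi', hb, hc]
    have h1 : (n.factorial : ℂ) ≠ 0 := Nat.cast_ne_zero.2 n.factorial_ne_zero
    field_simp
  have hBG : ∑ n ∈ Finset.range N, ‖b n‖ ^ 2 ≤ ∫ z, ‖F z‖ ∂circleHaar := by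
    have := ContinuousMap.sum_norm_sq_integralCLM_le circleHaar circleMonomial
      integral_circleMonomial (Finset.range N) G
    simp only [hG] at this
    refine this.trans_eq (integral_congr_ae (Filter.Eventually.of_forall fun z ↦ ?_))
    change ‖G z‖ ^ 2 = ‖F z‖
    rw [hFGH, norm_mul, ← hGH, sq]
  have hBH : ∑ n ∈ Finset.range N, ‖c n‖ ^ 2 ≤ ∫ z, ‖F z‖ ∂circleHaar := by
    have := ContinuousMap.sum_norm_sq_integralCLM_le circleHaar circleMonomial
      integral_circleMonomial (Finset.range N) H
    simp only [hH] at this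
    refine this.trans_eq (integral_congr_ae (Filter.Eventually.of_forall fun z ↦ ?_))
    change ‖H z‖ ^ 2 = ‖F z‖
    rw [hFGH, norm_mul, hGH, sq]
  calc _ ≤ ∑ n ∈ Finset.range N, ∑ i ∈ Finset.range (n + 1), ‖b i‖ ^ 2 * ‖c (n - i)‖ ^ 2 := by
        refine Finset.sum_le_sum fun n _ ↦ ?_
        rw [hFc, div_le_iff₀' (by positivity)]
        have h1 : ‖∑ i ∈ Finset.range (n + 1), b i * c (n - i)‖ ≤
            ∑ i ∈ Finset.range (n + 1), ‖b i‖ * ‖c (n - i)‖ :=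
          norm_sum_le_of_le _ fun i _ ↦ (norm_mul _ _).le
        refine (pow_le_pow_left₀ (norm_nonneg _) h1 2).trans ?_
        have h2 := sq_sum_le_card_mul_sum_sq (s := Finset.range (n + 1))
          (f := fun i ↦ ‖b i‖ * ‖c (n - i)‖)
        simpa [mul_pow] using h2
    _ = ∑ m ∈ Finset.range N, ∑ j ∈ Finset.range (N - m), ‖b m‖ ^ 2 * ‖c j‖ ^ 2 :=
        Finset.sum_range_diag_flip N fun i j ↦ ‖b i‖ ^ 2 * ‖c j‖ ^ 2
    _ ≤ ∑ m ∈ Finset.range N, ∑ j ∈ Finset.range N, ‖b m‖ ^ 2 * ‖c j‖ ^ 2 :=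
        Finset.sum_le_sum fun m _ ↦ Finset.sum_le_sum_of_subset_of_nonneg
          (Finset.range_mono (Nat.sub_le _ _)) fun _ _ _ ↦ by positivity
    _ = (∑ m ∈ Finset.range N, ‖b m‖ ^ 2) * ∑ j ∈ Finset.range N, ‖c j‖ ^ 2 := by
        rw [Finset.sum_mul_sum]
    _ ≤ (∫ z, ‖F z‖ ∂circleHaar) * ∫ z, ‖F z‖ ∂circleHaar := by gcongr
    _ = _ := (sq _).symm

/-- Carleman's inequality: the Hardy space `H¹` embeds contractively into the Bergman space `A²`. -/
theorem sum_norm_sq_div_le_sq_integral {d : ℕ} (c : Fin d → ℂ) :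
    ∑ n, ‖c n‖ ^ 2 / ((n : ℝ) + 1) ≤
      (∫ z : Circle, ‖∑ n, c n * (z : ℂ) ^ (n : ℕ)‖ ∂circleHaar) ^ 2 := by
  let p : Polynomial ℂ := ∑ n : Fin d, Polynomial.monomial (n : ℕ) (c n)
  have hp (w : ℂ) : p.eval w = ∑ n, c n * w ^ (n : ℕ) := by
    simp [p, Polynomial.eval_finsetSum]
  -- Roots on the unit circle prevent the factorization used here. Dilating the variable by a real s
  -- moves them off for all but finitely many s, and both sides are continuous in s, so s = 1
  -- follows by density.
  let S : Set ℝ := {s | ∑ n, ‖c n * (s : ℂ) ^ (n : ℕ)‖ ^ 2 / ((n : ℝ) + 1) ≤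
    (∫ z : Circle, ‖∑ n, c n * (s : ℂ) ^ (n : ℕ) * (z : ℂ) ^ (n : ℕ)‖ ∂circleHaar) ^ 2}
  have hS : IsClosed S := by
    refine isClosed_le (by fun_prop) (Continuous.pow ?_ 2)
    simp only [← setIntegral_univ (μ := circleHaar)]
    exact continuous_parametric_integral_of_continuous (by fun_prop) isCompact_univ
  let B : Set ℝ := insert 0 (((fun ρ : ℂ ↦ ‖ρ‖) '' p.roots.toFinset) ∪
    ((fun ρ : ℂ ↦ -‖ρ‖) '' p.roots.toFinset))
  have hB : B.Countable := (((p.roots.toFinset.finite_toSet.image _).union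
    (p.roots.toFinset.finite_toSet.image _)).insert 0).countable
  have hBS : Bᶜ ⊆ S := fun s hs ↦ by
    have hs0 : (s : ℂ) ≠ 0 := fun h ↦ hs (Or.inl (by exact_mod_cast h))
    have hbal := p.hasBalancedFactorization hs0 fun ρ hρ h ↦ by
      rw [Complex.norm_real, Real.norm_eq_abs] at h
      refine hs (Or.inr ?_)
      rcases abs_choice s with h1 | h1
      · exact Or.inl ⟨ρ, by simpa using hρ, by simp [h, h1]⟩
      · exact Or.inr ⟨ρ, by simpa using hρ, by simp [h, h1]⟩
    let F : C(Circle, ℂ) := ∑ n : Fin d, (c n * (s : ℂ) ^ (n : ℕ)) • circleMonomial n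
    have hF (z : Circle) : F z = ∑ n, c n * (s : ℂ) ^ (n : ℕ) * (z : ℂ) ^ (n : ℕ) := by
      simp [F, circleMonomial]
    have h1 := hbal.sum_norm_sq_le F (fun z ↦ by simp [hF, hp, mul_pow, mul_assoc]) d
    rw [← Fin.sum_univ_eq_sum_range (fun n ↦ ‖ContinuousMap.integralCLM circleHaar
      (star (circleMonomial n) * F)‖ ^ 2 / ((n : ℝ) + 1))] at h1
    simp only [hF] at h1
    refine le_trans (le_of_eq ?_) h1
    refine Finset.sum_congr rfl fun n _ ↦ ?_
    congr 3
    simp [F, Finset.mul_sum, integral_circleMonomial, Fin.val_inj]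
  have h1 : (1 : ℝ) ∈ S := by
    have h2 := hS.closure_subset_iff.2 hBS
    rw [(hB.dense_compl ℝ).closure_eq] at h2
    exact h2 trivial
  simpa [S] using h1

end Carleman

/-! ## The `L¹`-norm of a kernel -/

section KernelNorm

theorem integral_finCons {k : ℕ} {f : (Fin (k + 1) → Circle) → ℝ} (hf : Continuous f) :
    ∫ z, f z ∂polytorusHaar (k + 1) =
      ∫ w, ∫ x, f (Fin.cons x w) ∂circleHaar ∂polytorusHaar k := by
  have hm := (measurePreserving_piFinSuccAbove (fun _ : Fin (k + 1) ↦ circleHaar) 0).symm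
  have h1 : ∫ z, f z ∂polytorusHaar (k + 1) =
      ∫ p : Circle × (Fin k → Circle), f (Fin.cons p.1 p.2) ∂circleHaar.prod (polytorusHaar k) := by
    change ∫ z, f z ∂Measure.pi (fun _ : Fin (k + 1) ↦ circleHaar) = _
    rw [← hm.integral_comp']
    refine integral_congr_ae (Filter.Eventually.of_forall fun p ↦ congrArg f ?_)
    exact Fin.insertNth_zero (α := fun _ ↦ Circle) p.1 p.2
  have hc : Continuous fun p : Circle × (Fin k → Circle) ↦ f (Fin.cons p.1 p.2) :=
    hf.comp (Continuous.finCons continuous_fst continuous_snd)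
  rw [h1, integral_prod_symm]
  exact hc.integrable_of_hasCompactSupport (HasCompactSupport.of_compactSpace _)

/-- Minkowski's inequality for integrals of finite families. -/
theorem sqrt_sum_sq_integral_le {G ι : Type*} [Fintype ι] [MeasurableSpace G] {μ : Measure G}
    {f : ι → G → ℝ} (hf : ∀ i, Integrable (f i) μ) :
    √(∑ i, (∫ x, f i x ∂μ) ^ 2) ≤ ∫ x, √(∑ i, f i x ^ 2) ∂μ := by
  -- The inequality is the norm bound for the Bochner integral of a function with values in
  -- Euclidean space.
  have hint : Integrable (fun x ↦ WithLp.toLp 2 fun i ↦ f i x) μ :=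
    ((PiLp.continuousLinearEquiv 2 ℝ fun _ : ι ↦ ℝ).symm.toContinuousLinearMap).integrable_comp
      (Integrable.of_eval hf)
  have h := norm_integral_le_integral_norm (μ := μ) fun x ↦ WithLp.toLp 2 fun i ↦ f i x
  have h1 (i) : (∫ x, WithLp.toLp 2 (fun i ↦ f i x) ∂μ) i = ∫ x, f i x ∂μ :=
    ((EuclideanSpace.proj i : EuclideanSpace ℝ ι →L[ℝ] ℝ).integral_comp_comm hint).symm
  simpa only [EuclideanSpace.norm_eq, h1, Real.norm_eq_abs, sq_abs] using h

/-- Carleman's inequality on the polytorus. -/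
theorem sqrt_sum_norm_sq_div_le_integral {d : ℕ} : ∀ {k : ℕ} (c : (Fin k → Fin d) → ℂ),
    √(∑ α, ‖c α‖ ^ 2 * ∏ j, ((α j : ℝ) + 1)⁻¹) ≤
      ∫ z, ‖∑ α, c α * ∏ j, (z j : ℂ) ^ (α j : ℕ)‖ ∂polytorusHaar k
  | 0, c => by simp
  | k + 1, c => by
    let g (n : Fin d) (w : Fin k → Circle) : ℂ :=
      ∑ β : Fin k → Fin d, c (Fin.cons n β) * ∏ j, (w j : ℂ) ^ (β j : ℕ)
    have hg (n) : Continuous (g n) := by fun_prop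
    have hpos (n : Fin d) : (0 : ℝ) < (n : ℝ) + 1 := by positivity
    have hsum (x : Circle) (w : Fin k → Circle) :
        ∑ α : Fin (k + 1) → Fin d, c α * ∏ j, ((Fin.cons x w : Fin (k + 1) → Circle) j : ℂ) ^
          (α j : ℕ) = ∑ n, g n w * (x : ℂ) ^ (n : ℕ) := by
      rw [← (Fin.consEquiv fun _ : Fin (k + 1) ↦ Fin d).sum_comp, Fintype.sum_prod_type]
      refine Finset.sum_congr rfl fun n _ ↦ ?_
      rw [Finset.sum_mul]
      refine Finset.sum_congr rfl fun β _ ↦ ?_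
      change c (Fin.cons n β) * ∏ j : Fin (k + 1), ((Fin.cons x w : Fin (k + 1) → Circle) j : ℂ) ^
        ((Fin.cons n β : Fin (k + 1) → Fin d) j : ℕ) = _
      simp only [Fin.prod_univ_succ, Fin.cons_zero, Fin.cons_succ]
      ring
    rw [integral_finCons (by fun_prop)]
    simp only [hsum]
    -- Carleman in the first variable with the others frozen at w. Minkowski then moves the integral
    -- over w inside the ℓ²-norm, where the induction hypothesis applies to each g n.
    have h1 (w) : √(∑ n : Fin d, ((√((n : ℝ) + 1))⁻¹ * ‖g n w‖) ^ 2) ≤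
        ∫ x : Circle, ‖∑ n, g n w * (x : ℂ) ^ (n : ℕ)‖ ∂circleHaar := by
      refine Real.sqrt_le_iff.2 ⟨integral_nonneg fun _ ↦ norm_nonneg _, ?_⟩
      refine le_trans (le_of_eq ?_) (sum_norm_sq_div_le_sq_integral fun n ↦ g n w)
      refine Finset.sum_congr rfl fun n _ ↦ ?_
      rw [mul_pow, inv_pow, Real.sq_sqrt (hpos n).le, inv_mul_eq_div]
    have hi (n : Fin d) :
        Integrable (fun w ↦ (√((n : ℝ) + 1))⁻¹ * ‖g n w‖) (polytorusHaar k) :=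
      Continuous.integrable_of_hasCompactSupport (by fun_prop) (HasCompactSupport.of_compactSpace _)
    have hc1 : Continuous fun w ↦ ∫ x : Circle, ‖∑ n, g n w * (x : ℂ) ^ (n : ℕ)‖ ∂circleHaar := by
      simp only [← setIntegral_univ (μ := circleHaar)]
      exact continuous_parametric_integral_of_continuous (by fun_prop) isCompact_univ
    calc _ ≤ √(∑ n : Fin d, (∫ w, (√((n : ℝ) + 1))⁻¹ * ‖g n w‖ ∂polytorusHaar k) ^ 2) := by
          refine Real.sqrt_le_sqrt ?_
          rw [← (Fin.consEquiv fun _ : Fin (k + 1) ↦ Fin d).sum_comp, Fintype.sum_prod_type]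
          refine Finset.sum_le_sum fun n _ ↦ ?_
          rw [integral_const_mul, mul_pow, inv_pow, Real.sq_sqrt (hpos n).le]
          change ∑ β : Fin k → Fin d, ‖c (Fin.cons n β)‖ ^ 2 *
            ∏ j : Fin (k + 1), (((Fin.cons n β : Fin (k + 1) → Fin d) j : ℝ) + 1)⁻¹ ≤ _
          simp only [Fin.prod_univ_succ, Fin.cons_zero, Fin.cons_succ,
            mul_left_comm _ ((n : ℝ) + 1)⁻¹]
          rw [← Finset.mul_sum]
          refine mul_le_mul_of_nonneg_left ?_ (inv_nonneg.2 (hpos n).le)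
          exact (Real.sqrt_le_iff.1 (sqrt_sum_norm_sq_div_le_integral fun β ↦ c (Fin.cons n β))).2
      _ ≤ ∫ w, √(∑ n : Fin d, ((√((n : ℝ) + 1))⁻¹ * ‖g n w‖) ^ 2) ∂polytorusHaar k :=
          sqrt_sum_sq_integral_le hi
      _ ≤ _ := by
          refine integral_mono ?_ ?_ h1
          · exact Continuous.integrable_of_hasCompactSupport (by fun_prop)
              (HasCompactSupport.of_compactSpace _)
          · exact hc1.integrable_of_hasCompactSupport (HasCompactSupport.of_compactSpace _)

/-- The `L¹`-norm of a sum of monomials of degree at most `m` is at least `2 ^ (-m / 2)` times its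
`L²`-norm. -/
theorem sqrt_card_div_le_integral_norm_sum {k m : ℕ} (s : Finset (Fin k → ℕ))
    (hs : ∀ α ∈ s, ∑ j, α j ≤ m) :
    1 / √((2 : ℝ) ^ m) * √(s.card : ℝ) ≤
      ∫ z : Fin k → Circle, ‖∑ α ∈ s, ∏ j, (z j : ℂ) ^ α j‖ ∂polytorusHaar k := by
  let ι : (Fin k → Fin (m + 1)) → Fin k → ℕ := fun α j ↦ α j
  have hι : Function.Injective ι := fun α β h ↦ funext fun j ↦ Fin.ext (congrFun h j)
  have hsum {E : Type} [AddCommMonoid E] (f : (Fin k → ℕ) → E) :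
      ∑ α, (if ι α ∈ s then f (ι α) else 0) = ∑ α ∈ s, f α := by
    rw [← Finset.sum_filter]
    refine Finset.sum_nbij ι (fun α hα ↦ (Finset.mem_filter.1 hα).2) hι.injOn (fun α hα ↦ ?_)
      fun _ _ ↦ rfl
    have hlt (j) : α j < m + 1 := Nat.lt_succ_of_le
      ((Finset.single_le_sum (fun _ _ ↦ Nat.zero_le _) (Finset.mem_univ j)).trans (hs α hα))
    exact ⟨fun j ↦ ⟨α j, hlt j⟩, by simpa [ι] using hα, rfl⟩
  -- Each exponent is bounded by the degree, so s lies in the cube {0, …, m}^k and its indicator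
  -- serves as the coefficient family.
  have h := sqrt_sum_norm_sq_div_le_integral fun α : Fin k → Fin (m + 1) ↦
    if ι α ∈ s then (1 : ℂ) else 0
  have h1 (z : Fin k → Circle) : ∑ α : Fin k → Fin (m + 1), (if ι α ∈ s then (1 : ℂ) else 0) *
      ∏ j, (z j : ℂ) ^ (α j : ℕ) = ∑ α ∈ s, ∏ j, (z j : ℂ) ^ α j := by
    rw [← hsum]
    exact Finset.sum_congr rfl fun α _ ↦ by rw [ite_mul, one_mul, zero_mul]
  have h2 : ∑ α : Fin k → Fin (m + 1), ‖if ι α ∈ s then (1 : ℂ) else 0‖ ^ 2 *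
      ∏ j, ((α j : ℝ) + 1)⁻¹ = ∑ α ∈ s, ∏ j, ((α j : ℝ) + 1)⁻¹ := by
    rw [← hsum]
    refine Finset.sum_congr rfl fun α _ ↦ ?_
    split_ifs <;> simp [ι]
  simp only [h1] at h
  rw [h2] at h
  refine le_trans ?_ h
  rw [one_div, ← Real.sqrt_inv, ← Real.sqrt_mul (by positivity)]
  refine Real.sqrt_le_sqrt ?_
  rw [mul_comm, ← nsmul_eq_mul]
  refine Finset.card_nsmul_le_sum _ _ _ fun α hα ↦ ?_
  -- The constant comes from a + 1 ≤ 2^a applied in each coordinate.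
  calc ((2 : ℝ) ^ m)⁻¹ ≤ ((2 : ℝ) ^ ∑ j, α j)⁻¹ := by
        gcongr
        · norm_num
        · exact hs α hα
    _ = ∏ j, ((2 : ℝ) ^ α j)⁻¹ := by rw [← Finset.prod_pow_eq_pow_sum, Finset.prod_inv_distrib]
    _ ≤ ∏ j, ((α j : ℝ) + 1)⁻¹ := by
        refine Finset.prod_le_prod (fun _ _ ↦ by positivity) fun j _ ↦ ?_
        gcongr
        exact_mod_cast Nat.succ_le_of_lt Nat.lt_two_pow_self

/-- For a probability measure the L¹-norm is at most the L²-norm, which is √|s| by orthonormality of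
the characters. -/
theorem integral_norm_sum_le_sqrt_card {k : ℕ} (s : Finset (Fin k → ℕ)) :
    ∫ z : Fin k → Circle, ‖∑ α ∈ s, ∏ j, (z j : ℂ) ^ α j‖ ∂polytorusHaar k ≤ √(s.card : ℝ) := by
  let χ (α : Fin k → ℕ) : C(Fin k → Circle, ℂ) := torusMonomial fun j ↦ (α j : ℤ)
  let K : C(Fin k → Circle, ℂ) := ∑ α ∈ s, χ α
  have hK (z : Fin k → Circle) : ∑ α ∈ s, ∏ j, (z j : ℂ) ^ α j = K z := by
    simp [K, χ, torusMonomial_natCast_apply]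
  simp only [hK]
  have hsq : ∫ z, ‖K z‖ ^ 2 ∂polytorusHaar k = s.card := by
    have h1 : ContinuousMap.integralCLM (polytorusHaar k) (star K * K) = s.card := by
      have h (α β : Fin k → ℕ) : ContinuousMap.integralCLM (polytorusHaar k) (star (χ α) * χ β) =
          if α = β then 1 else 0 := by
        rw [star_torusMonomial, ← torusMonomial_add, ContinuousMap.integralCLM_apply,
          integral_torusMonomial]
        refine if_congr ?_ rfl rfl
        rw [neg_add_eq_zero]
        exact ⟨fun h ↦ funext fun j ↦ by exact_mod_cast congrFun h j, fun h ↦ by rw [h]⟩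
      simp [K, Finset.sum_mul, Finset.mul_sum, h]
    have h2 : ContinuousMap.integralCLM (polytorusHaar k) (star K * K) =
        ((∫ z, ‖K z‖ ^ 2 ∂polytorusHaar k : ℝ) : ℂ) := by
      rw [← integral_complex_ofReal]
      change ∫ z, (starRingEnd ℂ) (K z) * K z ∂_ = _
      congr 1 with z
      rw [Complex.conj_mul']
      push_cast
      rfl
    rw [h2] at h1
    exact_mod_cast h1
  refine Real.le_sqrt_of_sq_le ?_
  rw [← hsq]
  have hi {f : (Fin k → Circle) → ℝ} (hf : Continuous f) : Integrable f (polytorusHaar k) :=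
    hf.integrable_of_hasCompactSupport (HasCompactSupport.of_compactSpace f)
  set c := ∫ z, ‖K z‖ ∂polytorusHaar k with hc
  -- Nonnegativity of the variance of |K| gives Cauchy–Schwarz against the constant 1.
  have h0 : 0 ≤ ∫ z, (‖K z‖ - c) ^ 2 ∂polytorusHaar k := integral_nonneg fun _ ↦ sq_nonneg _
  have h1 : ∫ z, (‖K z‖ - c) ^ 2 ∂polytorusHaar k =
      ∫ z, ‖K z‖ ^ 2 ∂polytorusHaar k - 2 * c * c + c ^ 2 := by
    have (z : Fin k → Circle) : (‖K z‖ - c) ^ 2 = ‖K z‖ ^ 2 - 2 * c * ‖K z‖ + c ^ 2 := by ring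
    simp only [this]
    rw [integral_add (hi (by fun_prop)) (integrable_const _),
      integral_sub (hi (by fun_prop)) (hi (by fun_prop)), integral_const_mul, ← hc]
    simp
  linarith [sq c]

/-- Converts Ω(J) into the degree bound required by `sqrt_card_div_le_integral_norm_sum`. -/
theorem cardFactors_primePow {k : ℕ} (α : Fin k → ℕ) :
    ArithmeticFunction.cardFactors (primePow α) = ∑ j, α j := by
  have h (s : Finset (Fin k)) : ArithmeticFunction.cardFactors
      (∏ j ∈ s, Nat.nth Nat.Prime j ^ α j) = ∑ j ∈ s, α j := by
    induction s using Finset.induction_on with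
    | empty => simp
    | insert a s ha ih =>
      have hp (i : Fin k) : (Nat.nth Nat.Prime i).Prime := Nat.prime_nth_prime i
      rw [Finset.prod_insert ha, Finset.sum_insert ha, ArithmeticFunction.cardFactors_mul
        (pow_ne_zero _ (hp a).ne_zero)
        (Finset.prod_ne_zero_iff.2 fun i _ ↦ pow_ne_zero _ (hp i).ne_zero), ih,
        ArithmeticFunction.cardFactors_apply_prime_pow (hp a)]
  exact h _

end KernelNorm

end

/-- The hypothesis `hJ` expresses that ℕ starts at 1. With `Real.log 0 = 0`, the indices 0 and 1
would give the same exponential, and 0 is not a product of prime powers. -/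
theorem theorem2p12 (J : Finset ℕ) (hJ : 0 ∉ J) :
    projectionConstant.{0, v} (DirichletPolynomial (fun n ↦ Real.log n) J) =
      ENNReal.ofReal (∫ z : Fin (maxPrimeCounting J) → Circle,
        ‖∑ α ∈ primeExponents J, ∏ j, (z j : ℂ) ^ α j‖ ∂(polytorusHaar (maxPrimeCounting J))) ∧
    ENNReal.ofReal (1 / √((2 : ℝ) ^ maxCardFactors J) * √(J.card : ℝ)) ≤
      projectionConstant.{0, v} (DirichletPolynomial (fun n ↦ Real.log n) J) ∧
    projectionConstant.{0, v} (DirichletPolynomial (fun n ↦ Real.log n) J) ≤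
      ENNReal.ofReal √(J.card : ℝ) := by
  have h := projectionConstant_dirichletPolynomial.{v} hJ
  refine ⟨h, ?_, ?_⟩
  · rw [h, ← card_primeExponents hJ]
    refine ENNReal.ofReal_le_ofReal (sqrt_card_div_le_integral_norm_sum _ fun α hα ↦ ?_)
    rw [← cardFactors_primePow]
    have hα' : primePow α ∈ J := by simpa [primeExponents] using hα
    exact Finset.le_sup (f := fun n ↦ ArithmeticFunction.cardFactors n) hα'
  · rw [h, ← card_primeExponents hJ]
    exact ENNReal.ofReal_le_ofReal (integral_norm_sum_le_sqrt_card _)
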